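/- Let $M$ be a compact smooth $k$-dimensional Riemannian manifold with or without boundary, let $b_1,\dots,b_m$ ($m\ge 1$) be a basis of $\mathbb R^m$ with $|b_1|=1$, let $\Gamma=\{\sum_j l_jb_j:\ l_j\in\mathbb Z\}$, and let $\mathbb T=\mathbb R^m/\Gamma$. Fix the Dirichlet or the Neumann boundary condition on $\partial M\times\mathbb T$ (no condition if $\partial M=\emptyset$). For $\xi\in\mathbb R^m$ with $\langle\xi,b_1\rangle=0$ and $\tau\in\mathbb R$ put $z=(\pi+i\tau)b_1+\xi\in\mathbb C^m$ and let $H_0(\tau)=H_0(\tau;\xi)$ be the operator in $L_2(M\times\mathbb T)$ that corresponds to the closed sectorial form $$\int_{M\times\mathbb T}\Big(\langle\nabla_xu,\nabla_xv\rangle+\big\langle(\nabla_y+iz)u,(\nabla_y+i\overline z)v\big\rangle\Big)\,dx\,dy$$ with domain $H^1_0(M\times\mathbb T)$ (Dirichlet) or $H^1(M\times\mathbb T)$ (Neumann, or $\partial M=\emptyset$). The operator $H_0=H_0(0)$ is self-adjoint; for $n\in\mathbb N$, $n\ge1$, let $E_n$ be its spectral projector for the interval $[(n-1)^2,n^2)$,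 i.e. the orthogonal projection onto the closed span of the eigenfunctions of $H_0$ with eigenvalues in this interval. For $\tau\ne0$ let $|H_0(\tau)|^{-1/2}$ be the bounded operator in $L_2(M\times\mathbb T)$ that multiplies each eigenfunction of the normal operator $H_0(\tau)$, with eigenvalue $h\in\mathbb C$, by $|h|^{-1/2}$; that is, $|H_0(\tau)|^{-1/2}f=\sum_h|h|^{-1/2}P_hf$, where $P_h$ is the orthogonal projection onto the eigenspace of $H_0(\tau)$ for $h$. Let $1\le q\le\infty$ and assume Condition $\mathrm A(q)$: for every $\xi\in\mathbb R^m$ with $\langle\xi,b_1\rangle=0$ there are $\varepsilon>0$ and $C>0$ such that $$\|E_nf\|_{L_q(M\times\mathbb T)}\le C\,n^{1/2-\varepsilon}\,\|f\|_{L_2(M\times\mathbb T)}\qquad\text{for all } n\ge1,\ f\in L_2(M\times\mathbb T).$$ Then for every $\xi\in\mathbb R^m$ with $\langle\xi,b_1\rangle=0$ there are $\tau_0>0$ and $C>0$ such that for all real $\tau$ with $|\tau|>\tau_0$ and all $f\in L_2(M\times\mathbb T)$ the series defining $|H_0(\tau)|^{-1/2}f$ converges unconditionally in $L_2(M\times\mathbb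 T)$, and $$\big\||H_0(\tau)|^{-1/2}f\big\|_{L_q(M\times\mathbb T)}\le C\,\|f\|_{L_2(M\times\mathbb T)}.$$ -/

import Mathlib

open MeasureTheory Filter Topology Bundle
open scoped Manifold ContDiff ENNReal ComplexConjugate

noncomputable section

/-- The boundary condition on `∂M × ℝᵐ`. It plays no role if `M` has no boundary. -/
inductive BoundaryCondition where
  | dirichlet
  | neumann

section Cylinder

variable {k m : ℕ} {H : Type*} [TopologicalSpace H]
  (I : ModelWithCorners ℝ (EuclideanSpace ℝ (Fin k)) H)
  {M : Type*} [EMetricSpace M] [MeasurableSpace M] [BorelSpace M] [ChartedSpace H M]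
  (b : Module.Basis (Fin m) ℝ (EuclideanSpace ℝ (Fin m)))

variable (M) in
/-- The product measure `dx dy` on `M × 𝕋`, where `𝕋 = ℝᵐ / Γ` and `Γ` is the lattice spanned by
`b`. Functions on `M × 𝕋` are identified with `Γ`-periodic functions on `M × ℝᵐ`, that is, with
functions on `M × Ω`, where `Ω` is the elementary cell `{∑ yⱼ bⱼ : yⱼ ∈ [0, 1)}`.
The Riemannian volume `dx` on `M` is the `k`-dimensional Hausdorff measure of the Riemannian
distance, normalised so that it is the Lebesgue measure on Euclidean space. -/
def cylMeasure : Measure (M × EuclideanSpace ℝ (Fin m)) :=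
  (μHE[k] : Measure M).prod (volume.restrict (ZSpan.fundamentalDomain b))

variable (M k) in
/-- The Hilbert space `L₂(M × 𝕋)`. -/
abbrev CylL2 : Type _ := Lp ℂ 2 (cylMeasure (k := k) M b)

/-- The smooth functions `u` on `M × 𝕋` (smooth up to the boundary), i.e. the smooth `Γ`-periodic
functions on `M × ℝᵐ`. In the Dirichlet case the support of `u` in `M × 𝕋`, which is compact
as soon as `M` is, does not meet the boundary. Their closures in the norm of `H¹(M × 𝕋)`
are `H¹(M × 𝕋)` (Neumann) and `H¹₀(M × 𝕋)` (Dirichlet). -/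
def IsCore (bc : BoundaryCondition) (u : M × EuclideanSpace ℝ (Fin m) → ℂ) : Prop :=
  ContMDiff (I.prod 𝓘(ℝ, EuclideanSpace ℝ (Fin m))) 𝓘(ℝ, ℂ) ∞ u ∧
  (∀ x y j, u (x, y + b j) = u (x, y)) ∧
  match bc with
  | .dirichlet => tsupport u ⊆ {p | p.1 ∈ I.interior M}
  | .neumann => True

section Form

variable [RiemannianBundle (fun x : M => TangentSpace I x)]

instance instFiniteDimensionalTangentSpaceRiemannian (x : M) :
    FiniteDimensional ℝ (TangentSpace I x) :=
  inferInstanceAs (FiniteDimensional ℝ (EuclideanSpace ℝ (Fin k)))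

/-- The derivative of `u` in the direction of the `i`-th vector of an orthonormal basis of the
tangent space `T_x M`, at the point `p = (x, y)`. -/
def tangentDeriv (u : M × EuclideanSpace ℝ (Fin m) → ℂ) (p : M × EuclideanSpace ℝ (Fin m))
    (i : Fin (Module.finrank ℝ (TangentSpace I p.1))) : ℂ :=
  mfderiv I 𝓘(ℝ, ℂ) (fun x => u (x, p.2)) p.1 (stdOrthonormalBasis ℝ (TangentSpace I p.1) i)

/-- `⟨∇ₓ u, ∇ₓ v⟩` at the point `p = (x, y)`, linear in `u` and antilinear in `v`. It does not
depend on the choice of the orthonormal basis. -/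
def gradInner (u v : M × EuclideanSpace ℝ (Fin m) → ℂ) (p : M × EuclideanSpace ℝ (Fin m)) : ℂ :=
  ∑ i, tangentDeriv I u p i * conj (tangentDeriv I v p i)

/-- The `j`-th component of `(∇_y + i z) u` at the point `p = (x, y)`. -/
def magDeriv (z : Fin m → ℂ) (u : M × EuclideanSpace ℝ (Fin m) → ℂ) (j : Fin m)
    (p : M × EuclideanSpace ℝ (Fin m)) : ℂ :=
  fderiv ℝ (fun y => u (p.1, y)) p.2 (EuclideanSpace.single j 1) + Complex.I * z j * u p

/-- The sesquilinear form of the free operator with quasimomentum `z ∈ ℂᵐ`: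
`∫ ⟨∇ₓ u, ∇ₓ v⟩ + ⟨(∇_y + i z) u, (∇_y + i z̄) v⟩ dx dy` over `M × Ω`. -/
def freeForm (z : Fin m → ℂ) (u v : M × EuclideanSpace ℝ (Fin m) → ℂ) : ℂ :=
  ∫ p, (gradInner I u v p +
    ∑ j, magDeriv z u j p * conj (magDeriv (fun i => conj (z i)) v j p)) ∂(cylMeasure (k := k) M b)

/-- The functions `φ n` of the core converge to `u` in `L₂(M × 𝕋)` and are a Cauchy sequence for
`∫ |∇ φ|² dx dy`. So `u` lies in the form domain, `H¹(M × 𝕋)` or `H¹₀(M × 𝕋)`, exactly if such a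
sequence exists. -/
def IsFormApprox (bc : BoundaryCondition) (u : CylL2 k M b)
    (φ : ℕ → M × EuclideanSpace ℝ (Fin m) → ℂ) : Prop :=
  (∀ n, IsCore I b bc (φ n)) ∧
  Tendsto (fun n => eLpNorm (fun p => φ n p - u p) 2 (cylMeasure (k := k) M b)) atTop (𝓝 0) ∧
  Tendsto (fun n : ℕ × ℕ => freeForm I b 0 (fun p => φ n.1 p - φ n.2 p)
    (fun p => φ n.1 p - φ n.2 p)) atTop (𝓝 0)

/-- `u` is in the domain of the operator in `L₂(M × 𝕋)` that corresponds to the closed sectorial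
form `freeForm z`, and this operator sends `u` to `g`: `u` is in the form domain, and the form
sends `(u, ψ)` to `(g, ψ)` for all `ψ` in the core, which is dense in the form domain. -/
def FreeOperatorGraph (bc : BoundaryCondition) (z : Fin m → ℂ) (u g : CylL2 k M b) : Prop :=
  ∃ φ : ℕ → M × EuclideanSpace ℝ (Fin m) → ℂ, IsFormApprox I b bc u φ ∧
    ∀ ψ, IsCore I b bc ψ → Tendsto (fun n => freeForm I b z (φ n) ψ) atTop
      (𝓝 (∫ p, g p * conj (ψ p) ∂(cylMeasure (k := k) M b)))

variable [NeZero m]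

/-- The quasimomentum `(π + i τ) b₁ + ξ`; here `b₁` is `b 0`. -/
def quasimomentum (ξ : EuclideanSpace ℝ (Fin m)) (τ : ℝ) : Fin m → ℂ :=
  fun j => ((Real.pi : ℂ) + Complex.I * (τ : ℂ)) * ((b 0 j : ℝ) : ℂ) + ((ξ j : ℝ) : ℂ)

/-- The eigenspace of `H₀(τ) = H₀((π + i τ) b₁ + ξ)` for the eigenvalue `h ∈ ℂ` (it is closed
already, as `H₀(τ)` is a closed operator). -/
def eigenspaceH0 (bc : BoundaryCondition) (ξ : EuclideanSpace ℝ (Fin m)) (τ : ℝ) (h : ℂ) :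
    Submodule ℂ (CylL2 k M b) :=
  (Submodule.span ℂ {u | FreeOperatorGraph I b bc (quasimomentum b ξ τ) u (h • u)}).topologicalClosure

/-- The spectral projector `E_n` of the self-adjoint operator `H₀ = H₀(0)`, whose spectrum is
discrete, for the interval `[(n - 1)², n²)`: the orthogonal projection onto the closed span of the
eigenfunctions of `H₀` whose eigenvalues lie in this interval. -/
def clusterProj (bc : BoundaryCondition) (ξ : EuclideanSpace ℝ (Fin m)) (n : ℕ) :
    CylL2 k M b →L[ℂ] CylL2 k M b :=
  ((⨆ μ ∈ Set.Ico (((n : ℝ) - 1) ^ 2) ((n : ℝ) ^ 2),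
    eigenspaceH0 I b bc ξ 0 ((μ : ℝ) : ℂ)).topologicalClosure).starProjection

/-- The term of `|H₀(τ)|^{-1/2} f` that belongs to the eigenvalue `h` of `H₀(τ)`: the orthogonal
projection of `f` onto the eigenspace, times `|h|^{-1/2}`. -/
def absInvSqrtTerm (bc : BoundaryCondition) (ξ : EuclideanSpace ℝ (Fin m)) (τ : ℝ)
    (f : CylL2 k M b) (h : ℂ) : CylL2 k M b :=
  ((‖h‖ ^ (-(1 / 2) : ℝ) : ℝ) : ℂ) •
    (((eigenspaceH0 I b bc ξ τ h).topologicalClosure).starProjection f)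

/-- `|H₀(τ)|^{-1/2} f`, the sum of the terms above in `L₂(M × 𝕋)`: the operator that multiplies
every eigenfunction of the normal operator `H₀(τ)`, with eigenvalue `h`, by `|h|^{-1/2}`. -/
def absInvSqrtH0 (bc : BoundaryCondition) (ξ : EuclideanSpace ℝ (Fin m)) (τ : ℝ)
    (f : CylL2 k M b) : CylL2 k M b :=
  ∑' h : ℂ, absInvSqrtTerm I b bc ξ τ f h

variable (M) in
/-- Condition `A(q)`: for every real `ξ ⊥ b₁` there are `ε, C > 0` such that
`‖E_n f‖_{L_q} ≤ C n^{1/2 - ε} ‖f‖_{L₂}` for all `n ≥ 1` and `f ∈ L₂(M × 𝕋)`. -/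
def ConditionA (bc : BoundaryCondition) (q : ℝ≥0∞) : Prop :=
  ∀ ξ : EuclideanSpace ℝ (Fin m), inner ℝ ξ (b 0) = 0 →
    ∃ ε : ℝ, 0 < ε ∧ ∃ C : ℝ, 0 < C ∧ ∀ n : ℕ, 1 ≤ n → ∀ f : CylL2 k M b,
      eLpNorm (clusterProj I b bc ξ n f) q (cylMeasure (k := k) M b) ≤
        ENNReal.ofReal (C * (n : ℝ) ^ (1 / 2 - ε) * ‖f‖)

end Form

end Cylinder

end

/-!
The translations of `M × 𝕋` along `b₁` commute with `H₀(τ)`, and with `D` the derivative along `b₁`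
the form of `H₀(τ)` is the form of `H₀(0)` plus `2 τ ⟪·, D ·⟫ + (2 π i τ - τ ^ 2) ⟪·, ·⟫`
(`freeForm_quasimomentum`). This is all that has to be known about `H₀(τ)`; in particular neither
the compactness of its resolvent nor the completeness of its eigenfunctions is used.

Testing the weak eigenvalue equations of two eigenvectors `u`, `v` with each other, and using that
the form of `H₀(0)` is Hermitian and `D` antisymmetric, gives a relation between `⟪v, D u⟫` and
`⟪v, u⟫` (`IsWeakEigen.inner_deriv`). Applied to an eigenvector `u` for the eigenvalue `h` and its
translates `U_s u`, it is a linear differential equation for `⟪u, U_s u⟫`, so that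
`U_s u = exp (i θ s) u` with `θ = Im h / (2 τ) - π` (`IsWeakEigen.l2Translate_eq`). There are three
consequences. The translation by the lattice vector `b₁` is trivial, so `|Im h| ≥ 2 π |τ|`
(`IsWeakEigen.le_abs_im`). As `D u = i θ u`, the vector `u` is an eigenvector of `H₀(0)` for the
eigenvalue `Re h + τ ^ 2 ≥ 0` (`IsWeakEigen.isWeakEigen_zero`). And eigenvectors for different
eigenvalues of `H₀(τ)` are orthogonal (`IsWeakEigen.inner_eq_zero`). By Bessel's inequality and the
lower bound for `|h|`, the series defining `|H₀(τ)|^{-1/2} f` converges.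

For the bound in `L_q` the eigenvectors of `H₀(τ)` are sorted into the ranges of the projectors
`E_n`. If `Re h + τ ^ 2` lies in `[(n - 1) ^ 2, n ^ 2)`, then `|h|` is at least of the order
`(1 + |n - |τ||) (n + |τ|)` (`inv_norm_le_clusterWeight`). Condition `A(q)` on each cluster and the
Cauchy–Schwarz inequality over the clusters (`eLpNorm_sum_smul_starProjection_le`) reduce the claim
to a bound, uniform in `τ`, for the sum over `n` of
`n ^ (1 - 2 ε) / ((1 + |n - |τ||) (n + |τ|)) ≤ (1 + |n - |τ||) ^ (-1 - 2 ε)`,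
which is `exists_sum_rpow_le`. Infinite sums are reached by the lower semicontinuity of the norm of
`L_q` (`eLpNorm_tsum_le`).
-/

noncomputable section

/-! ### Finiteness of the Riemannian volume -/

section Volume

open Set Metric

attribute [local instance] normedAddCommGroupTangentSpaceVectorSpace
  normedSpaceTangentSpaceVectorSpace
open scoped NNReal

variable {k m : ℕ} {H : Type*} [TopologicalSpace H]
  (I : ModelWithCorners ℝ (EuclideanSpace ℝ (Fin k)) H)
  {M : Type*} [EMetricSpace M] [ChartedSpace H M] [IsManifold I ∞ M]
  [RiemannianBundle (fun x : M => TangentSpace I x)]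
  [IsContMDiffRiemannianBundle I ∞ (EuclideanSpace ℝ (Fin k)) (fun x : M => TangentSpace I x)]

lemma isContinuousRiemannianBundle_tangentSpace :
    IsContinuousRiemannianBundle (EuclideanSpace ℝ (Fin k)) (fun x : M => TangentSpace I x) := by
  obtain ⟨g, hg, h⟩ := ‹IsContMDiffRiemannianBundle I ∞ (EuclideanSpace ℝ (Fin k))
    (fun x : M => TangentSpace I x)›.exists_contMDiff
  exact ⟨g, hg.continuous, h⟩

/-- The inverse of a chart of a Riemannian manifold is Lipschitz near the centre of the chart:
a segment in the (convex) range of the model is mapped to a path of controlled length. -/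
lemma exists_lipschitzOnWith_extChartAt_symm [IsRiemannianManifold I M] (x : M) :
    ∃ C : ℝ≥0, ∃ r > (0 : ℝ),
      LipschitzOnWith C (extChartAt I x).symm (ball (extChartAt I x x) r ∩ range I) := by
  have := isContinuousRiemannianBundle_tangentSpace I (M := M)
  rcases eventually_enorm_mfderivWithin_symm_extChartAt_lt I x with ⟨C, C_pos, hC⟩
  obtain ⟨S, hS, hSC⟩ := hC.exists_mem
  obtain ⟨r, r_pos, hr⟩ : ∃ r > 0,
      ball (extChartAt I x x) r ∩ range I ⊆ (extChartAt I x).target ∩ S :=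
    mem_nhdsWithin_iff.1 (inter_mem (extChartAt_target_mem_nhdsWithin x) hS)
  refine ⟨C, r, r_pos, fun u hu v hv => ?_⟩
  rw [IsRiemannianManifold.out (I := I)]
  let η := ContinuousAffineMap.lineMap (R := ℝ) u v
  set γ := (extChartAt I x).symm ∘ η
  have hη : Icc 0 1 ⊆ ⇑η ⁻¹' ((extChartAt I x).target ∩ S) := by
    simp only [← image_subset_iff, ContinuousAffineMap.coe_lineMap_eq,
     ← segment_eq_image_lineMap, η]
    apply Subset.trans _ hr
    exact ((convex_ball _ _).inter I.convex_range).segment_subset hu hv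
  simp only [preimage_inter, subset_inter_iff] at hη
  have η_smooth : CMDiff[Icc 0 1] 1 η := by
    apply ContMDiff.contMDiffOn
    rw [contMDiff_iff_contDiff]
    exact ContinuousAffineMap.contDiff _
  have : Manifold.riemannianEDist I ((extChartAt I x).symm u) ((extChartAt I x).symm v)
      ≤ Manifold.pathELength I γ 0 1 := by
    apply Manifold.riemannianEDist_le_pathELength _ _ _ zero_le_one
    · exact (contMDiffOn_extChartAt_symm x).comp η_smooth hη.1
    · simp [γ, η, ContinuousAffineMap.coe_lineMap_eq]
    · simp [γ, η, ContinuousAffineMap.coe_lineMap_eq]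
  apply this.trans
  rw [← lintegral_fderiv_lineMap_eq_edist, Manifold.pathELength_eq_lintegral_mfderivWithin_Icc,
    ← lintegral_const_mul' _ _ ENNReal.coe_ne_top]
  apply setLIntegral_mono' measurableSet_Icc (fun t ht ↦ ?_)
  have : mfderiv[Icc 0 1] γ t =
      (mfderiv[range I] (extChartAt I x).symm (η t)) ∘L (mfderiv[Icc 0 1] η t) := by
    apply mfderivWithin_comp
    · exact mdifferentiableWithinAt_extChartAt_symm (hη.1 ht)
    · exact η_smooth.mdifferentiableOn one_ne_zero t ht
    · exact hη.1.trans (preimage_mono (extChartAt_target_subset_range x))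
    · rw [uniqueMDiffWithinAt_iff_uniqueDiffWithinAt]
      exact uniqueDiffOn_Icc zero_lt_one t ht
  have : mfderiv[Icc 0 1] γ t 1 =
      (mfderiv[range I] (extChartAt I x).symm (η t)) (mfderiv[Icc 0 1] η t 1) := congr($this 1)
  rw [this]
  apply (ContinuousLinearMap.le_opENorm _ _).trans
  gcongr
  · exact (hSC _ (hη.2 ht)).le
  · simp only [mfderivWithin_eq_fderivWithin]
    exact le_of_eq rfl

end Volume

section FiniteVolume

open Set Metric

/-- The Riemannian volume is locally finite. -/
lemma exists_mem_nhds_euclideanHausdorffMeasure_lt_top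
    {k : ℕ} {H : Type*} [TopologicalSpace H]
    (I : ModelWithCorners ℝ (EuclideanSpace ℝ (Fin k)) H)
    {M : Type*} [EMetricSpace M] [ChartedSpace H M] [IsManifold I ∞ M]
    [RiemannianBundle (fun x : M => TangentSpace I x)]
    [IsContMDiffRiemannianBundle I ∞ (EuclideanSpace ℝ (Fin k)) (fun x : M => TangentSpace I x)]
    [IsRiemannianManifold I M] [MeasurableSpace M] [BorelSpace M]
    (x : M) :
    ∃ s ∈ 𝓝 x, (μHE[k] : Measure M) s < ⊤ := by
  obtain ⟨C, r, r_pos, hC⟩ := exists_lipschitzOnWith_extChartAt_symm I x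
  set B := ball (extChartAt I x x) r ∩ range I
  refine ⟨(extChartAt I x).symm '' B, ?_, ?_⟩
  · have A : (extChartAt I x) ⁻¹' B ∈ 𝓝 x := by
      apply extChartAt_preimage_mem_nhds_of_mem_nhdsWithin (by simp)
      rw [show B = range I ∩ ball (extChartAt I x x) r from inter_comm _ _]
      exact inter_mem_nhdsWithin _ (ball_mem_nhds _ r_pos)
    filter_upwards [A, extChartAt_source_mem_nhds (I := I) x] with y hy h'y
    exact ⟨_, hy, (extChartAt I x).left_inv h'y⟩
  · have h1 := hC.hausdorffMeasure_image_le (d := (k : ℝ)) (by positivity)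
    have h2 : (μHE[k] : Measure (EuclideanSpace ℝ (Fin k))) B < ⊤ := by
      rw [EuclideanSpace.euclideanHausdorffMeasure_eq_volume]
      exact (measure_mono inter_subset_left).trans_lt measure_ball_lt_top
    rw [Measure.euclideanHausdorffMeasure_def, Measure.smul_apply] at h2 ⊢
    have h3 : μH[k] B < ⊤ := by
      by_contra h
      rw [not_lt, top_le_iff] at h
      rw [h] at h2
      simp [ENNReal.smul_def, Measure.addHaarScalarFactor_volume_hausdorffMeasure_ne_zero] at h2
    rw [ENNReal.smul_def]
    refine ENNReal.mul_lt_top ENNReal.coe_lt_top (h1.trans_lt (ENNReal.mul_lt_top ?_ h3))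
    exact ENNReal.rpow_lt_top_of_nonneg (by positivity) ENNReal.coe_ne_top

/-- The Riemannian volume of a compact manifold is finite. -/
lemma isFiniteMeasure_euclideanHausdorffMeasure
    {k : ℕ} {H : Type*} [TopologicalSpace H]
    (I : ModelWithCorners ℝ (EuclideanSpace ℝ (Fin k)) H)
    {M : Type*} [EMetricSpace M] [ChartedSpace H M] [IsManifold I ∞ M]
    [RiemannianBundle (fun x : M => TangentSpace I x)]
    [IsContMDiffRiemannianBundle I ∞ (EuclideanSpace ℝ (Fin k)) (fun x : M => TangentSpace I x)]
    [IsRiemannianManifold I M] [MeasurableSpace M] [BorelSpace M]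
    [CompactSpace M] :
    IsFiniteMeasure (μHE[k] : Measure M) :=
  ⟨isCompact_univ.measure_lt_top_of_nhdsWithin fun x _ => by
    simpa [Measure.FiniteAtFilter, nhdsWithin_univ] using
      exists_mem_nhds_euclideanHausdorffMeasure_lt_top I x⟩

instance isFiniteMeasure_cylMeasure {k m : ℕ} {M : Type*} [EMetricSpace M] [MeasurableSpace M]
    [BorelSpace M] [IsFiniteMeasure (μHE[k] : Measure M)]
    (b : Module.Basis (Fin m) ℝ (EuclideanSpace ℝ (Fin m))) :
    IsFiniteMeasure (cylMeasure (k := k) M b) := by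
  have : IsFiniteMeasure (volume.restrict (ZSpan.fundamentalDomain b)) :=
    ⟨by simpa using (ZSpan.fundamentalDomain_isBounded b).measure_lt_top⟩
  unfold cylMeasure
  infer_instance

end FiniteVolume

/-! ### Translations of the torus -/

section Translation

open Set

variable {k m : ℕ} (b : Module.Basis (Fin m) ℝ (EuclideanSpace ℝ (Fin m)))

lemma ZSpan.measurable_fract : Measurable (ZSpan.fract b) := by
  have h : ZSpan.fract b = fun y => ∑ i, Int.fract (b.repr y i) • b i := by
    ext1 y
    rw [← b.sum_repr (ZSpan.fract b y)]
    simp only [ZSpan.repr_fract_apply]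
  rw [h]
  refine Finset.measurable_sum _ fun i _ => Measurable.smul_const ?_ _
  refine _root_.measurable_fract.comp ?_
  exact (LinearMap.continuous_of_finiteDimensional (b.coord i)).measurable

/-- The translation by `v` of the torus `ℝᵐ / Γ`, read in the elementary cell, preserves the
Lebesgue measure. -/
lemma measurePreserving_fract_add (v : EuclideanSpace ℝ (Fin m)) :
    MeasurePreserving (fun y => ZSpan.fract b (y + v))
      (volume.restrict (ZSpan.fundamentalDomain b))
      (volume.restrict (ZSpan.fundamentalDomain b)) := by
  have hm : Measurable (fun y => ZSpan.fract b (y + v)) :=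
    (ZSpan.measurable_fract b).comp (measurable_id.add_const v)
  refine ⟨hm, ?_⟩
  ext A hA
  have hΩ := ZSpan.fundamentalDomain_measurableSet b
  rw [Measure.map_apply hm hA, Measure.restrict_apply (hm hA), Measure.restrict_apply hA]
  set S : Set (EuclideanSpace ℝ (Fin m)) := ZSpan.fract b ⁻¹' A with hS
  have hSm : MeasurableSet S := ZSpan.measurable_fract b hA
  have hΩ1 := ZSpan.isAddFundamentalDomain' b (volume : Measure (EuclideanSpace ℝ (Fin m)))
  have hΩ2 : IsAddFundamentalDomain (Submodule.span ℤ (range b)).toAddSubgroup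
      ((fun y => y - v) ⁻¹' ZSpan.fundamentalDomain b) volume := by
    refine IsAddFundamentalDomain.mk' (measurable_id.sub_const v hΩ).nullMeasurableSet fun x => ?_
    have := ZSpan.exist_unique_vadd_mem_fundamentalDomain b (x - v)
    simp only [Submodule.vadd_def, vadd_eq_add, ← add_sub_assoc] at this
    exact this
  have h1 : A ∩ ZSpan.fundamentalDomain b = S ∩ ZSpan.fundamentalDomain b := by
    ext y
    simp only [mem_inter_iff, hS, mem_preimage, and_congr_left_iff]
    intro hy
    rw [ZSpan.fract_eq_self.2 hy]
  have : Countable (Submodule.span ℤ (range b)).toAddSubgroup :=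
    inferInstanceAs (Countable (Submodule.span ℤ (range b)))
  -- the cell and its translate by `v` are both fundamental domains of `Γ`, and `S` is invariant
  rw [h1, hΩ1.measure_set_eq hΩ2 hSm]
  · have h2 : (fun y => ZSpan.fract b (y + v)) ⁻¹' A ∩ ZSpan.fundamentalDomain b =
        (fun y => y + v) ⁻¹' (S ∩ (fun y => y - v) ⁻¹' ZSpan.fundamentalDomain b) := by
      ext y
      simp [hS]
    rw [h2, measure_preimage_add_right]
  · intro g
    ext y
    simp only [hS, mem_preimage]
    exact iff_of_eq (congrArg (· ∈ A) (ZSpan.fract_zSpan_add b y g.2))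

variable {M : Type*} [EMetricSpace M] [MeasurableSpace M] [BorelSpace M]

/-- The translation by `v` in the second variable of `M × 𝕋`, read in `M × Ω`. -/
def cylShift (v : EuclideanSpace ℝ (Fin m)) (p : M × EuclideanSpace ℝ (Fin m)) :
    M × EuclideanSpace ℝ (Fin m) :=
  (p.1, ZSpan.fract b (p.2 + v))

lemma measurePreserving_cylShift [SFinite (μHE[k] : Measure M)]
    (v : EuclideanSpace ℝ (Fin m)) :
    MeasurePreserving (cylShift (M := M) b v) (cylMeasure (k := k) M b)
      (cylMeasure (k := k) M b) :=
  (MeasurePreserving.id _).prod (measurePreserving_fract_add b v)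

end Translation

/-! ### Continuity of the derivatives of smooth functions -/

section Continuity

variable {k m : ℕ} {H : Type*} [TopologicalSpace H]
  {I : ModelWithCorners ℝ (EuclideanSpace ℝ (Fin k)) H}
  {M : Type*} [EMetricSpace M] [ChartedSpace H M] [IsManifold I ∞ M]

/-- The derivative of `u` in the direction `v` of the second factor of `M × ℝᵐ`. -/
def torusDeriv (v : EuclideanSpace ℝ (Fin m)) (u : M × EuclideanSpace ℝ (Fin m) → ℂ)
    (p : M × EuclideanSpace ℝ (Fin m)) : ℂ :=
  fderiv ℝ (fun y => u (p.1, y)) p.2 v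

lemma ContMDiff.continuous_torusDeriv {u : M × EuclideanSpace ℝ (Fin m) → ℂ}
    (hu : ContMDiff (I.prod 𝓘(ℝ, EuclideanSpace ℝ (Fin m))) 𝓘(ℝ, ℂ) ∞ u)
    (v : EuclideanSpace ℝ (Fin m)) : Continuous (torusDeriv v u) := by
  rw [continuous_iff_continuousAt]
  intro p
  have h := ContMDiffAt.mfderiv (J := I.prod 𝓘(ℝ, EuclideanSpace ℝ (Fin m)))
    (I := 𝓘(ℝ, EuclideanSpace ℝ (Fin m))) (I' := 𝓘(ℝ, ℂ)) (n := ∞) (m := 0) (x₀ := p)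
    (fun (p : M × EuclideanSpace ℝ (Fin m)) (y : EuclideanSpace ℝ (Fin m)) => u (p.1, y))
    (fun p => p.2) ?_ contMDiffAt_snd (by simp)
  · have h' := h.continuousAt.clm_apply (continuousAt_const (y := v))
    refine h'.congr (Eventually.of_forall fun p => ?_)
    simp only [inTangentCoordinates, ContinuousLinearMap.inCoordinates, mfderiv_eq_fderiv,
      TangentBundle.continuousLinearMapAt_model_space, TangentBundle.symmL_model_space]
    rfl
  · refine (hu.comp (f := fun q : (M × EuclideanSpace ℝ (Fin m)) × EuclideanSpace ℝ (Fin m) =>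
      (q.1.1, q.2)) ?_).contMDiffAt
    exact (contMDiff_fst.comp contMDiff_fst).prodMk contMDiff_snd

/-- The derivative of `u` along a vector field that is constant in a local trivialization of the
tangent bundle of `M` is continuous. -/
lemma ContMDiff.continuousAt_mfderiv_frame {u : M × EuclideanSpace ℝ (Fin m) → ℂ}
    (hu : ContMDiff (I.prod 𝓘(ℝ, EuclideanSpace ℝ (Fin m))) 𝓘(ℝ, ℂ) ∞ u)
    (p₀ : M × EuclideanSpace ℝ (Fin m)) (v : EuclideanSpace ℝ (Fin k)) :
    ContinuousAt (fun p : M × EuclideanSpace ℝ (Fin m) =>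
      (mfderiv I 𝓘(ℝ, ℂ) (fun x => u (x, p.2)) p.1
        ((trivializationAt (EuclideanSpace ℝ (Fin k)) (TangentSpace I) p₀.1).symm p.1 v) : ℂ))
      p₀ := by
  have h := ContMDiffAt.mfderiv (J := I.prod 𝓘(ℝ, EuclideanSpace ℝ (Fin m)))
    (I := I) (I' := 𝓘(ℝ, ℂ)) (n := ∞) (m := 0) (x₀ := p₀)
    (fun (p : M × EuclideanSpace ℝ (Fin m)) (x : M) => u (x, p.2))
    (fun p => p.1) ?_ contMDiffAt_fst (by simp)
  · have h' := h.continuousAt.clm_apply (continuousAt_const (y := v))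
    have hp₀ : ∀ᶠ p : M × EuclideanSpace ℝ (Fin m) in 𝓝 p₀, p.1 ∈
        (trivializationAt (EuclideanSpace ℝ (Fin k)) (TangentSpace I : M → Type _) p₀.1).baseSet :=
      continuousAt_fst.eventually ((trivializationAt (EuclideanSpace ℝ (Fin k))
        (TangentSpace I : M → Type _) p₀.1).open_baseSet.mem_nhds
        (FiberBundle.mem_baseSet_trivializationAt' p₀.1))
    refine h'.congr ?_
    filter_upwards [hp₀] with p hp
    rw [← Trivialization.symmL_apply (R := ℝ) _ hp]
    simp only [inTangentCoordinates, ContinuousLinearMap.inCoordinates,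
      TangentBundle.continuousLinearMapAt_model_space]
    rfl
  · refine (hu.comp (f := fun q : (M × EuclideanSpace ℝ (Fin m)) × M =>
      (q.2, q.1.2)) ?_).contMDiffAt
    exact contMDiff_snd.prodMk (contMDiff_snd.comp contMDiff_fst)

lemma continuousAt_frame (x₀ : M) (v : EuclideanSpace ℝ (Fin k)) :
    ContinuousAt (fun x : M => (⟨x, (trivializationAt (EuclideanSpace ℝ (Fin k))
      (TangentSpace I) x₀).symm x v⟩ : TangentBundle I M)) x₀ := by
  set e := trivializationAt (EuclideanSpace ℝ (Fin k)) (TangentSpace I : M → Type _) x₀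
  have hx : e.baseSet ∈ 𝓝 x₀ :=
    e.open_baseSet.mem_nhds (FiberBundle.mem_baseSet_trivializationAt' x₀)
  rw [FiberBundle.continuousAt_totalSpace]
  refine ⟨continuousAt_id, ?_⟩
  refine (continuousAt_const (y := v)).congr ?_
  filter_upwards [hx] with x hx
  exact (congrArg Prod.snd (e.apply_mk_symm hx v)).symm

end Continuity

/-- The pairing of two functionals over an orthonormal basis, computed in an arbitrary basis `w` by
means of the inverse of its Gram matrix. -/
lemma OrthonormalBasis.sum_mul_conj_eq_gram {V : Type*} [NormedAddCommGroup V]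
    [InnerProductSpace ℝ V] {ι κ : Type*} [Fintype ι] [Fintype κ] [DecidableEq ι] [DecidableEq κ]
    (e : OrthonormalBasis ι ℝ V) (w : Module.Basis κ ℝ V) (α β : V →ₗ[ℝ] ℂ) :
    ∑ i, α (e i) * conj (β (e i)) =
      ∑ j, ∑ l, (((Matrix.of fun j l => inner ℝ (w j) (w l))⁻¹ j l : ℝ) : ℂ) *
        (α (w j) * conj (β (w l))) := by
  set G : Matrix κ κ ℝ := Matrix.of fun j l => inner ℝ (w j) (w l) with hG
  set C : Matrix κ ι ℝ := Matrix.of fun j i => w.repr (e i) j with hC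
  have he : ∀ i, e i = ∑ j, C j i • w j := fun i => (w.sum_repr (e i)).symm
  have h1 : C.transpose * (G * C) = 1 := by
    ext i i'
    have h := orthonormal_iff_ite.1 e.orthonormal i i'
    rw [he i, he i', sum_inner] at h
    simp only [inner_sum, real_inner_smul_left, real_inner_smul_right] at h
    rw [Matrix.one_apply, ← h, Matrix.mul_apply]
    refine Finset.sum_congr rfl fun j _ => ?_
    rw [Matrix.mul_apply, Finset.mul_sum]
    refine Finset.sum_congr rfl fun l _ => ?_
    simp only [Matrix.transpose_apply, hG, Matrix.of_apply]
    ring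
  have hcard : Fintype.card ι = Fintype.card κ := by
    rw [← Module.finrank_eq_card_basis e.toBasis, ← Module.finrank_eq_card_basis w]
  have h2 : G * C * C.transpose = 1 := (Matrix.mul_eq_one_comm_of_card_eq ι κ ℝ hcard).1 h1
  have h3 : G⁻¹ = C * C.transpose := Matrix.inv_eq_right_inv (by rw [← Matrix.mul_assoc, h2])
  rw [h3]
  simp only [Matrix.mul_apply, Matrix.transpose_apply]
  push_cast
  simp only [Finset.sum_mul]
  have : ∀ i, α (e i) * conj (β (e i)) =
      ∑ j, ∑ l, (C j i : ℂ) * (C l i : ℂ) * (α (w j) * conj (β (w l))) := by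
    intro i
    rw [he i, map_sum, map_sum, map_sum, Finset.sum_mul_sum]
    refine Finset.sum_congr rfl fun j _ => Finset.sum_congr rfl fun l _ => ?_
    simp only [map_smul, Complex.real_smul, map_mul, Complex.conj_ofReal]
    ring
  simp only [this]
  rw [Finset.sum_comm]
  refine Finset.sum_congr rfl fun j _ => ?_
  rw [Finset.sum_comm]

section Continuity

variable {k m : ℕ} {H : Type*} [TopologicalSpace H]
  {I : ModelWithCorners ℝ (EuclideanSpace ℝ (Fin k)) H}
  {M : Type*} [EMetricSpace M] [ChartedSpace H M] [IsManifold I ∞ M]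
  [RiemannianBundle (fun x : M => TangentSpace I x)]
  [IsContMDiffRiemannianBundle I ∞ (EuclideanSpace ℝ (Fin k)) (fun x : M => TangentSpace I x)]

/-- The pairing `⟨∇ₓ u, ∇ₓ w⟩` of smooth functions is continuous, although it is defined through an
arbitrary choice of an orthonormal basis in each tangent space. -/
lemma ContMDiff.continuous_gradInner {u w : M × EuclideanSpace ℝ (Fin m) → ℂ}
    (hu : ContMDiff (I.prod 𝓘(ℝ, EuclideanSpace ℝ (Fin m))) 𝓘(ℝ, ℂ) ∞ u)
    (hw : ContMDiff (I.prod 𝓘(ℝ, EuclideanSpace ℝ (Fin m))) 𝓘(ℝ, ℂ) ∞ w) :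
    Continuous (gradInner I u w) := by
  have := isContinuousRiemannianBundle_tangentSpace I (M := M)
  rw [continuous_iff_continuousAt]
  intro p₀
  set e := trivializationAt (EuclideanSpace ℝ (Fin k)) (TangentSpace I : M → Type _) p₀.1 with he
  have hp₀ : p₀.1 ∈ e.baseSet := FiberBundle.mem_baseSet_trivializationAt' p₀.1
  -- near `p₀` the pairing is expressed in a local frame `s`, whose Gram matrix `G` is continuous
  let s : Fin k → (x : M) → TangentSpace I x := fun j x => e.symm x (EuclideanSpace.single j 1)
  let G : M → Matrix (Fin k) (Fin k) ℝ := fun x => Matrix.of fun j l => inner ℝ (s j x) (s l x)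
  let W : (x : M) → x ∈ e.baseSet → Module.Basis (Fin k) ℝ (TangentSpace I x) := fun x hx =>
    (EuclideanSpace.basisFun (Fin k) ℝ).toBasis.map
      (e.continuousLinearEquivAt ℝ x hx).symm.toLinearEquiv
  have hW : ∀ x hx j, W x hx j = s j x := by
    intro x hx j
    simp [W, s]
  have hG : ContinuousAt G p₀.1 := by
    refine continuousAt_pi.2 fun j => continuousAt_pi.2 fun l => ?_
    exact ContinuousAt.inner_bundle (continuousAt_frame (I := I) p₀.1 (EuclideanSpace.single j 1))
      (continuousAt_frame (I := I) p₀.1 (EuclideanSpace.single l 1))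
  have hdet : (G p₀.1).det ≠ 0 := by
    have h : G p₀.1 = Matrix.gram ℝ (W p₀.1 hp₀) := by
      ext j l
      simp [G, Matrix.gram_apply, hW]
    rw [h, Matrix.det_gram_ne_zero_iff_linearIndependent]
    exact (W p₀.1 hp₀).linearIndependent
  have hGinv : ContinuousAt (fun x => (G x)⁻¹) p₀.1 := by
    simp only [Matrix.inv_def, Ring.inverse_eq_inv']
    refine ContinuousAt.smul (f := fun x => (G x).det⁻¹) (g := fun x => (G x).adjugate)
      (ContinuousAt.inv₀ ?_ hdet) ?_
    · exact (continuous_id.matrix_det.continuousAt).comp hG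
    · exact (continuous_id.matrix_adjugate.continuousAt).comp hG
  let d : (M × EuclideanSpace ℝ (Fin m) → ℂ) → (p : M × EuclideanSpace ℝ (Fin m)) →
    TangentSpace I p.1 →ₗ[ℝ] ℂ := fun f p =>
      (mfderiv I 𝓘(ℝ, ℂ) (fun x => f (x, p.2)) p.1).toLinearMap
  have hev : gradInner I u w =ᶠ[𝓝 p₀] fun p => ∑ j, ∑ l, (((G p.1)⁻¹ j l : ℝ) : ℂ) *
      (d u p (s j p.1) * conj (d w p (s l p.1))) := by
    have : ∀ᶠ p in 𝓝 p₀, p.1 ∈ e.baseSet :=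
      continuousAt_fst.eventually (e.open_baseSet.mem_nhds hp₀)
    filter_upwards [this] with p hp
    have h := (stdOrthonormalBasis ℝ (TangentSpace I p.1)).sum_mul_conj_eq_gram (W p.1 hp)
      (d u p) (d w p)
    simp only [hW] at h
    exact h
  refine ContinuousAt.congr ?_ hev.symm
  refine tendsto_finsetSum _ fun j _ => tendsto_finsetSum _ fun l _ => ?_
  refine ContinuousAt.mul ?_ (ContinuousAt.mul ?_ ?_)
  · refine Complex.continuous_ofReal.continuousAt.comp ?_
    exact (continuousAt_pi.1 (continuousAt_pi.1 hGinv j) l).comp continuousAt_fst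
  · exact hu.continuousAt_mfderiv_frame p₀ _
  · exact Complex.continuous_conj.continuousAt.comp (hw.continuousAt_mfderiv_frame p₀ _)

end Continuity

/-! ### Integrability of continuous functions on the cylinder -/

section Integrability

variable {k m : ℕ} {M : Type*} [EMetricSpace M] [CompactSpace M] [MeasurableSpace M] [BorelSpace M]
  [IsFiniteMeasure (μHE[k] : Measure M)]
  (b : Module.Basis (Fin m) ℝ (EuclideanSpace ℝ (Fin m)))

omit [CompactSpace M] in
lemma ae_mem_fundamentalDomain :
    ∀ᵐ p ∂(cylMeasure (k := k) M b), p.2 ∈ ZSpan.fundamentalDomain b := by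
  have h : cylMeasure (k := k) M b = ((μHE[k] : Measure M).prod volume).restrict
      ((Set.univ : Set M) ×ˢ ZSpan.fundamentalDomain b) := by
    rw [← Measure.prod_restrict, Measure.restrict_univ, cylMeasure]
  rw [h]
  filter_upwards [ae_restrict_mem (MeasurableSet.univ.prod
    (ZSpan.fundamentalDomain_measurableSet b))] with x hx
  exact hx.2

/-- A continuous function on `M × ℝᵐ` is bounded on the relatively compact set `M × Ω`. -/
lemma Continuous.memLp_cylMeasure {F : M × EuclideanSpace ℝ (Fin m) → ℂ} (hF : Continuous F)
    (p : ℝ≥0∞) : MemLp F p (cylMeasure (k := k) M b) := by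
  have : SecondCountableTopology M := EMetric.secondCountable_of_sigmaCompact M
  have hK : IsCompact ((Set.univ : Set M) ×ˢ closure (ZSpan.fundamentalDomain b)) :=
    isCompact_univ.prod (ZSpan.fundamentalDomain_isBounded b).isCompact_closure
  obtain ⟨C, hC⟩ := hK.exists_bound_of_continuousOn hF.continuousOn
  refine MemLp.of_bound hF.aestronglyMeasurable C ?_
  filter_upwards [ae_mem_fundamentalDomain b] with x hx
  exact hC x ⟨trivial, subset_closure hx⟩

lemma Continuous.integrable_cylMeasure {F : M × EuclideanSpace ℝ (Fin m) → ℂ}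
    (hF : Continuous F) : Integrable F (cylMeasure (k := k) M b) :=
  memLp_one_iff_integrable.1 (hF.memLp_cylMeasure b 1)

end Integrability

/-! ### Algebra of the integrand of the form -/

section Algebra

variable {k m : ℕ} {H : Type*} [TopologicalSpace H]
  {I : ModelWithCorners ℝ (EuclideanSpace ℝ (Fin k)) H}
  {M : Type*} [EMetricSpace M] [ChartedSpace H M]

lemma ContMDiff.differentiableAt_torus {u : M × EuclideanSpace ℝ (Fin m) → ℂ}
    (hu : ContMDiff (I.prod 𝓘(ℝ, EuclideanSpace ℝ (Fin m))) 𝓘(ℝ, ℂ) ∞ u)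
    (x : M) (y : EuclideanSpace ℝ (Fin m)) : DifferentiableAt ℝ (fun y => u (x, y)) y := by
  have h : ContMDiff 𝓘(ℝ, EuclideanSpace ℝ (Fin m)) 𝓘(ℝ, ℂ) ∞ (fun y => u (x, y)) :=
    hu.comp (contMDiff_const.prodMk contMDiff_id)
  exact (h.contDiff.differentiable (by simp)) y

lemma ContMDiff.mdifferentiableAt_fst {u : M × EuclideanSpace ℝ (Fin m) → ℂ}
    (hu : ContMDiff (I.prod 𝓘(ℝ, EuclideanSpace ℝ (Fin m))) 𝓘(ℝ, ℂ) ∞ u)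
    (x : M) (y : EuclideanSpace ℝ (Fin m)) : MDifferentiableAt I 𝓘(ℝ, ℂ) (fun x => u (x, y)) x :=
  ((hu.comp (contMDiff_id.prodMk contMDiff_const)).mdifferentiable (by simp)) x

variable {u w : M × EuclideanSpace ℝ (Fin m) → ℂ}
  (hu : ContMDiff (I.prod 𝓘(ℝ, EuclideanSpace ℝ (Fin m))) 𝓘(ℝ, ℂ) ∞ u)
  (hw : ContMDiff (I.prod 𝓘(ℝ, EuclideanSpace ℝ (Fin m))) 𝓘(ℝ, ℂ) ∞ w)

include hu

lemma torusDeriv_const_smul (v : EuclideanSpace ℝ (Fin m)) (c : ℂ)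
    (p : M × EuclideanSpace ℝ (Fin m)) : torusDeriv v (c • u) p = c * torusDeriv v u p := by
  have h := ((hu.differentiableAt_torus p.1 p.2).hasFDerivAt.const_smul c).fderiv
  exact congrArg (fun L => L v) h

include hw

lemma torusDeriv_add (v : EuclideanSpace ℝ (Fin m)) (p : M × EuclideanSpace ℝ (Fin m)) :
    torusDeriv v (u + w) p = torusDeriv v u p + torusDeriv v w p := by
  have h := ((hu.differentiableAt_torus p.1 p.2).hasFDerivAt.add
    (hw.differentiableAt_torus p.1 p.2).hasFDerivAt).fderiv
  exact congrArg (fun L => L v) h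

omit hu hw

lemma magDeriv_eq {X : Type*} (z : Fin m → ℂ) (u : X × EuclideanSpace ℝ (Fin m) → ℂ) (j : Fin m)
    (p : X × EuclideanSpace ℝ (Fin m)) :
    magDeriv z u j p = torusDeriv (EuclideanSpace.single j 1) u p + Complex.I * z j * u p :=
  rfl

variable [RiemannianBundle (fun x : M => TangentSpace I x)]

include hu

lemma tangentDeriv_const_smul (c : ℂ) (p : M × EuclideanSpace ℝ (Fin m))
    (i : Fin (Module.finrank ℝ (TangentSpace I p.1))) :
    tangentDeriv I (c • u) p i = c * tangentDeriv I u p i := by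
  have h := ((ContinuousLinearMap.hasMFDerivAt (c • ContinuousLinearMap.id ℝ ℂ)
    (x := u (p.1, p.2))).comp p.1 (hu.mdifferentiableAt_fst p.1 p.2).hasMFDerivAt).mfderiv
  exact congrArg (fun L => L (stdOrthonormalBasis ℝ (TangentSpace I p.1) i)) h

include hw

lemma tangentDeriv_add (p : M × EuclideanSpace ℝ (Fin m))
    (i : Fin (Module.finrank ℝ (TangentSpace I p.1))) :
    tangentDeriv I (u + w) p i = tangentDeriv I u p i + tangentDeriv I w p i := by
  have h := ((hu.mdifferentiableAt_fst p.1 p.2).hasMFDerivAt.add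
    (hw.mdifferentiableAt_fst p.1 p.2).hasMFDerivAt).mfderiv
  exact congrArg (fun L => L (stdOrthonormalBasis ℝ (TangentSpace I p.1) i)) h

end Algebra

section Density

variable {k m : ℕ} {H : Type*} [TopologicalSpace H]
  (I : ModelWithCorners ℝ (EuclideanSpace ℝ (Fin k)) H)
  {M : Type*} [EMetricSpace M] [ChartedSpace H M]
  [RiemannianBundle (fun x : M => TangentSpace I x)]

/-- The integrand of `freeForm`. -/
def formDensity (z : Fin m → ℂ) (u v : M × EuclideanSpace ℝ (Fin m) → ℂ)
    (p : M × EuclideanSpace ℝ (Fin m)) : ℂ :=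
  gradInner I u v p + ∑ j, magDeriv z u j p * conj (magDeriv (fun i => conj (z i)) v j p)

variable {I}

lemma conj_formDensity (z : Fin m → ℂ) (u v : M × EuclideanSpace ℝ (Fin m) → ℂ)
    (p : M × EuclideanSpace ℝ (Fin m)) :
    conj (formDensity I z u v p) = formDensity I (fun i => conj (z i)) v u p := by
  simp only [formDensity, gradInner, map_add, map_sum, map_mul, Complex.conj_conj, mul_comm]

lemma formDensity_add_left (z : Fin m → ℂ) {u u' : M × EuclideanSpace ℝ (Fin m) → ℂ}
    (hu : ContMDiff (I.prod 𝓘(ℝ, EuclideanSpace ℝ (Fin m))) 𝓘(ℝ, ℂ) ∞ u)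
    (hu' : ContMDiff (I.prod 𝓘(ℝ, EuclideanSpace ℝ (Fin m))) 𝓘(ℝ, ℂ) ∞ u')
    (v : M × EuclideanSpace ℝ (Fin m) → ℂ) (p : M × EuclideanSpace ℝ (Fin m)) :
    formDensity I z (u + u') v p = formDensity I z u v p + formDensity I z u' v p := by
  simp only [formDensity, gradInner, tangentDeriv_add hu hu', magDeriv_eq, torusDeriv_add hu hu',
    add_mul, Finset.sum_add_distrib, Pi.add_apply, mul_add]
  ring

lemma formDensity_smul_left (z : Fin m → ℂ) {u : M × EuclideanSpace ℝ (Fin m) → ℂ}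
    (hu : ContMDiff (I.prod 𝓘(ℝ, EuclideanSpace ℝ (Fin m))) 𝓘(ℝ, ℂ) ∞ u) (c : ℂ)
    (v : M × EuclideanSpace ℝ (Fin m) → ℂ) (p : M × EuclideanSpace ℝ (Fin m)) :
    formDensity I z (c • u) v p = c * formDensity I z u v p := by
  simp only [formDensity, gradInner, tangentDeriv_const_smul hu, magDeriv_eq,
    torusDeriv_const_smul hu, Pi.smul_apply, smul_eq_mul, mul_add, Finset.mul_sum]
  congr 1
  · exact Finset.sum_congr rfl fun i _ => by ring
  · exact Finset.sum_congr rfl fun i _ => by ring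

/-- The density of the form with a real quasimomentum, on the diagonal. -/
lemma formDensity_self {z : Fin m → ℂ} (hz : ∀ i, conj (z i) = z i)
    (u : M × EuclideanSpace ℝ (Fin m) → ℂ) (p : M × EuclideanSpace ℝ (Fin m)) :
    formDensity I z u u p =
      ((∑ i, ‖tangentDeriv I u p i‖ ^ 2 + ∑ j, ‖magDeriv z u j p‖ ^ 2 : ℝ) : ℂ) := by
  simp only [formDensity, gradInner, hz, Complex.mul_conj, Complex.normSq_eq_norm_sq]
  push_cast
  rfl

lemma sum_mul_torusDeriv_single {X : Type*} (v : EuclideanSpace ℝ (Fin m))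
    (u : X × EuclideanSpace ℝ (Fin m) → ℂ) (p : X × EuclideanSpace ℝ (Fin m)) :
    ∑ j, (v j : ℂ) * torusDeriv (EuclideanSpace.single j 1) u p = torusDeriv v u p := by
  unfold torusDeriv
  conv_rhs => rw [← (EuclideanSpace.basisFun (Fin m) ℝ).sum_repr v]
  simp only [map_sum, map_smul, Complex.real_smul, EuclideanSpace.basisFun_apply,
    EuclideanSpace.basisFun_repr]

/-- Dependence of the form on `τ`: passing from `τ = 0` to `τ` adds terms of first order, which
only involve the derivative along `b₁`, and terms of order zero. -/
lemma formDensity_quasimomentum [NeZero m]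
    {b : Module.Basis (Fin m) ℝ (EuclideanSpace ℝ (Fin m))} (hb : ‖b 0‖ = 1)
    {ξ : EuclideanSpace ℝ (Fin m)} (hξ : inner ℝ ξ (b 0) = 0) (τ : ℝ)
    (u v : M × EuclideanSpace ℝ (Fin m) → ℂ) (p : M × EuclideanSpace ℝ (Fin m)) :
    formDensity I (quasimomentum b ξ τ) u v p = formDensity I (quasimomentum b ξ 0) u v p
      + (τ * (torusDeriv (b 0) u p * conj (v p) - u p * conj (torusDeriv (b 0) v p))
        + (2 * Real.pi * Complex.I * τ - τ ^ 2) * (u p * conj (v p))) := by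
  have hb2 : ∑ j, ((b 0 j : ℝ) : ℂ) ^ 2 = 1 := by
    have h := EuclideanSpace.norm_sq_eq (b 0)
    rw [hb] at h
    simp only [Real.norm_eq_abs, sq_abs, one_pow] at h
    exact_mod_cast h.symm
  have hbx : ∑ j, ((b 0 j : ℝ) : ℂ) * ((ξ j : ℝ) : ℂ) = 0 := by
    rw [PiLp.inner_apply] at hξ
    simp only [RCLike.inner_apply, conj_trivial] at hξ
    exact_mod_cast hξ
  -- the terms with `⟨b₁, ξ⟩` vanish after summation, and `|b₁| = 1`
  have hterm : ∀ j, magDeriv (quasimomentum b ξ τ) u j p *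
        conj (magDeriv (fun i => conj (quasimomentum b ξ τ i)) v j p) =
      magDeriv (quasimomentum b ξ 0) u j p *
        conj (magDeriv (fun i => conj (quasimomentum b ξ 0 i)) v j p) +
      (τ * (((b 0 j : ℝ) : ℂ) * torusDeriv (EuclideanSpace.single j 1) u p) * conj (v p)
        - τ * u p * conj (((b 0 j : ℝ) : ℂ) * torusDeriv (EuclideanSpace.single j 1) v p)
        + (2 * Real.pi * Complex.I * τ - τ ^ 2) * (u p * conj (v p)) * ((b 0 j : ℝ) : ℂ) ^ 2
        + 2 * Complex.I * τ * (u p * conj (v p)) * (((b 0 j : ℝ) : ℂ) * ((ξ j : ℝ) : ℂ))) := by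
    intro j
    simp only [magDeriv_eq, quasimomentum, map_add, map_mul, map_neg, neg_neg, Complex.conj_I,
      Complex.conj_ofReal, Complex.ofReal_zero, mul_zero, add_zero]
    linear_combination (-(u p * conj (v p)) * (((b 0 j : ℝ) : ℂ) ^ 2 * (2 * Real.pi * Complex.I * τ
      + τ ^ 2 * (Complex.I ^ 2 - 1)) + 2 * Complex.I * τ * ((b 0 j : ℝ) : ℂ) * ((ξ j : ℝ) : ℂ))
      + τ * ((b 0 j : ℝ) : ℂ) * (torusDeriv (EuclideanSpace.single j 1) u p * conj (v p)
        - u p * conj (torusDeriv (EuclideanSpace.single j 1) v p)) * (-1)) * Complex.I_sq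
  simp only [formDensity]
  rw [Finset.sum_congr rfl fun j _ => hterm j]
  rw [Finset.sum_add_distrib, Finset.sum_add_distrib, Finset.sum_add_distrib,
    Finset.sum_sub_distrib, ← Finset.sum_mul, ← Finset.mul_sum, ← Finset.mul_sum, ← Finset.mul_sum,
    ← Finset.mul_sum, ← map_sum, sum_mul_torusDeriv_single, sum_mul_torusDeriv_single, hb2, hbx]
  ring

end Density

/-! ### Hilbert spaces from Hermitian forms -/

/-- A positive semidefinite Hermitian form is the pull-back of the inner product of a Hilbert
space. -/
lemma exists_inner_eq_of_nonneg.{v} {V : Type v} [AddCommGroup V] [Module ℂ V] (B : V → V → ℂ)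
    (hsymm : ∀ u v, conj (B u v) = B v u) (hpos : ∀ u, 0 ≤ (B u u).re)
    (hadd : ∀ u u' v, B (u + u') v = B u v + B u' v)
    (hsmul : ∀ (c : ℂ) u v, B (c • u) v = c * B u v) :
    ∃ (K : Type v) (_ : NormedAddCommGroup K) (_ : InnerProductSpace ℂ K)
      (J : V →ₗ[ℂ] K), CompleteSpace K ∧ ∀ u v, inner ℂ (J v) (J u) = B u v := by
  let c : PreInnerProductSpace.Core ℂ V :=
    { inner := fun u v => B v u
      conj_inner_symm := fun u v => hsymm u v
      re_inner_nonneg := fun u => hpos u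
      add_left := fun u u' v => by
        rw [← hsymm, hadd, map_add, hsymm, hsymm]
      smul_left := fun u v r => by
        rw [← hsymm, hsmul, map_mul, hsymm] }
  let _ : SeminormedAddCommGroup V := @InnerProductSpace.Core.toSeminormedAddCommGroup ℂ V _ _ _ c
  let _ : InnerProductSpace ℂ V := InnerProductSpace.ofCore c
  refine ⟨UniformSpace.Completion V, inferInstance, inferInstance,
    UniformSpace.Completion.toComplₗᵢ.toLinearMap, inferInstance, fun u v => ?_⟩
  exact UniformSpace.Completion.inner_coe v u

/-! ### The core and its translations -/

section Core

variable {k m : ℕ} {H : Type*} [TopologicalSpace H]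
  (I : ModelWithCorners ℝ (EuclideanSpace ℝ (Fin k)) H)
  (M : Type*) [EMetricSpace M] [ChartedSpace H M]
  (b : Module.Basis (Fin m) ℝ (EuclideanSpace ℝ (Fin m))) (bc : BoundaryCondition)

/-- The space of the functions satisfying `IsCore`. -/
def coreSubmodule : Submodule ℂ (M × EuclideanSpace ℝ (Fin m) → ℂ) where
  carrier := {u | IsCore I b bc u}
  zero_mem' := by
    refine ⟨contMDiff_const, fun _ _ _ => rfl, ?_⟩
    cases bc
    · simp
    · trivial
  add_mem' := by
    intro u w hu hw
    refine ⟨hu.1.add hw.1, fun x y j => ?_, ?_⟩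
    · simp only [Pi.add_apply, hu.2.1, hw.2.1]
    · cases bc
      · exact (tsupport_add u w).trans (Set.union_subset hu.2.2 hw.2.2)
      · trivial
  smul_mem' := by
    intro c u hu
    refine ⟨?_, fun x y j => ?_, ?_⟩
    · exact (c • ContinuousLinearMap.id ℝ ℂ).contMDiff.comp hu.1
    · simp only [Pi.smul_apply, hu.2.1]
    · cases bc
      · exact (closure_mono (Function.support_const_smul_subset c u)).trans hu.2.2
      · trivial

variable {I M b bc}

lemma IsCore.periodic {u : M × EuclideanSpace ℝ (Fin m) → ℂ} (hu : IsCore I b bc u) (x : M)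
    (y : EuclideanSpace ℝ (Fin m)) {v : EuclideanSpace ℝ (Fin m)}
    (hv : v ∈ Submodule.span ℤ (Set.range b)) : u (x, y + v) = u (x, y) := by
  induction hv using Submodule.span_induction generalizing y with
  | mem v hv =>
    obtain ⟨j, rfl⟩ := hv
    exact hu.2.1 x y j
  | zero => simp
  | add v w _ _ hv hw => rw [← add_assoc, hw, hv]
  | smul n v _ hv =>
    induction n with
    | zero => simp
    | succ n ih => rw [add_smul, one_smul, ← add_assoc, hv, ih]
    | pred n ih => rw [← hv (y + _), sub_smul, one_smul, add_assoc, sub_add_cancel, ih]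

/-- Translation by `v` in the second factor of `M × ℝᵐ`. -/
def cylTranslate {X : Type*} (v : EuclideanSpace ℝ (Fin m)) (u : X × EuclideanSpace ℝ (Fin m) → ℂ)
    (p : X × EuclideanSpace ℝ (Fin m)) : ℂ :=
  u (p.1, p.2 + v)

lemma IsCore.cylTranslate {u : M × EuclideanSpace ℝ (Fin m) → ℂ} (hu : IsCore I b bc u)
    (v : EuclideanSpace ℝ (Fin m)) : IsCore I b bc (cylTranslate v u) := by
  refine ⟨?_, fun x y j => ?_, ?_⟩
  · refine hu.1.comp (contMDiff_fst.prodMk ?_)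
    exact (contDiff_id.add contDiff_const).contMDiff.comp contMDiff_snd
  · simp only [_root_.cylTranslate, add_right_comm y (b j) v, hu.2.1]
  · cases bc
    · have hc : Continuous fun p : M × EuclideanSpace ℝ (Fin m) => (p.1, p.2 + v) := by fun_prop
      intro p hp
      have h := hu.2.2 (tsupport_comp_subset_preimage u hc hp)
      exact h
    · trivial

lemma torusDeriv_cylTranslate {X : Type*} (v w : EuclideanSpace ℝ (Fin m))
    (u : X × EuclideanSpace ℝ (Fin m) → ℂ) :
    torusDeriv w (cylTranslate v u) = cylTranslate v (torusDeriv w u) := by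
  ext p
  simp only [torusDeriv, cylTranslate]
  rw [fderiv_comp_add_right (f := fun y => u (p.1, y)) v]

lemma IsCore.torusDeriv_periodic {u : M × EuclideanSpace ℝ (Fin m) → ℂ} (hu : IsCore I b bc u)
    (w : EuclideanSpace ℝ (Fin m)) (x : M) (y : EuclideanSpace ℝ (Fin m))
    {v : EuclideanSpace ℝ (Fin m)} (hv : v ∈ Submodule.span ℤ (Set.range b)) :
    torusDeriv w u (x, y + v) = torusDeriv w u (x, y) := by
  have h : _root_.cylTranslate v u = u := by
    ext p
    exact hu.periodic p.1 p.2 hv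
  conv_rhs => rw [← h, torusDeriv_cylTranslate]
  rfl

/-- For a periodic function it does not matter whether a translate is read in `M × ℝᵐ` or in the
elementary cell. -/
lemma comp_cylShift_of_periodic {X : Type*} {F : X × EuclideanSpace ℝ (Fin m) → ℂ}
    (hF : ∀ x y, ∀ v ∈ Submodule.span ℤ (Set.range b), F (x, y + v) = F (x, y))
    (v : EuclideanSpace ℝ (Fin m)) (p : X × EuclideanSpace ℝ (Fin m)) :
    F (p.1, ZSpan.fract b (p.2 + v)) = F (p.1, p.2 + v) := by
  rw [← hF p.1 (ZSpan.fract b (p.2 + v)) (ZSpan.floor b (p.2 + v)) (ZSpan.floor b (p.2 + v)).2,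
    ZSpan.fract_apply, sub_add_cancel]

lemma formDensity_cylTranslate [RiemannianBundle (fun x : M => TangentSpace I x)]
    (z : Fin m → ℂ) (v : EuclideanSpace ℝ (Fin m)) (u w : M × EuclideanSpace ℝ (Fin m) → ℂ) :
    formDensity I z (cylTranslate v u) (cylTranslate v w) =
      cylTranslate v (formDensity I z u w) := by
  ext p
  simp only [formDensity, magDeriv_eq, torusDeriv_cylTranslate]
  rfl

lemma IsCore.formDensity_periodic [RiemannianBundle (fun x : M => TangentSpace I x)]
    {u w : M × EuclideanSpace ℝ (Fin m) → ℂ} (hu : IsCore I b bc u) (hw : IsCore I b bc w)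
    (z : Fin m → ℂ) (x : M) (y : EuclideanSpace ℝ (Fin m))
    (v : EuclideanSpace ℝ (Fin m)) (hv : v ∈ Submodule.span ℤ (Set.range b)) :
    formDensity I z u w (x, y + v) = formDensity I z u w (x, y) := by
  have h : ∀ {u : M × EuclideanSpace ℝ (Fin m) → ℂ}, IsCore I b bc u →
      _root_.cylTranslate v u = u := fun hu => by
    ext p
    exact hu.periodic p.1 p.2 hv
  conv_rhs => rw [← h hu, ← h hw, formDensity_cylTranslate]
  rfl

/-- The translation of the core by the vector `v` of the torus. -/
def coreTranslate (v : EuclideanSpace ℝ (Fin m)) (u : coreSubmodule I M b bc) :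
    coreSubmodule I M b bc :=
  ⟨cylTranslate v u.1, IsCore.cylTranslate u.2 v⟩

lemma coreTranslate_neg (v : EuclideanSpace ℝ (Fin m)) (u : coreSubmodule I M b bc) :
    coreTranslate v (coreTranslate (-v) u) = u := by
  ext p
  simp [coreTranslate, cylTranslate]

@[simp]
lemma coreTranslate_zero (u : coreSubmodule I M b bc) : coreTranslate 0 u = u := by
  ext p
  simp [coreTranslate, cylTranslate]

lemma IsCore.hasDerivAt_line {u : M × EuclideanSpace ℝ (Fin m) → ℂ} (hu : IsCore I b bc u)
    (v : EuclideanSpace ℝ (Fin m)) (p : M × EuclideanSpace ℝ (Fin m)) (s : ℝ) :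
    HasDerivAt (fun s : ℝ => u (p.1, p.2 + s • v)) (torusDeriv v u (p.1, p.2 + s • v)) s := by
  have h1 := (hu.1.differentiableAt_torus p.1 (p.2 + s • v)).hasFDerivAt
  have h2 : HasDerivAt (fun s : ℝ => p.2 + s • v) v s := by
    simpa using ((hasDerivAt_id s).smul_const v).const_add p.2
  exact h1.comp_hasDerivAt s h2

end Core

section Form

variable {k m : ℕ} {H : Type*} [TopologicalSpace H]
  {I : ModelWithCorners ℝ (EuclideanSpace ℝ (Fin k)) H}
  {M : Type*} [EMetricSpace M] [ChartedSpace H M] [IsManifold I ∞ M]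
  [RiemannianBundle (fun x : M => TangentSpace I x)]
  [IsContMDiffRiemannianBundle I ∞ (EuclideanSpace ℝ (Fin k)) (fun x : M => TangentSpace I x)]

lemma ContMDiff.continuous_formDensity {u w : M × EuclideanSpace ℝ (Fin m) → ℂ}
    (hu : ContMDiff (I.prod 𝓘(ℝ, EuclideanSpace ℝ (Fin m))) 𝓘(ℝ, ℂ) ∞ u)
    (hw : ContMDiff (I.prod 𝓘(ℝ, EuclideanSpace ℝ (Fin m))) 𝓘(ℝ, ℂ) ∞ w) (z : Fin m → ℂ) :
    Continuous (formDensity I z u w) := by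
  have hm : ∀ {u : M × EuclideanSpace ℝ (Fin m) → ℂ} (z : Fin m → ℂ) (j : Fin m),
      ContMDiff (I.prod 𝓘(ℝ, EuclideanSpace ℝ (Fin m))) 𝓘(ℝ, ℂ) ∞ u →
      Continuous (magDeriv z u j) := fun z j hu =>
    (hu.continuous_torusDeriv _).add (continuous_const.mul hu.continuous)
  refine (hu.continuous_gradInner hw).add (continuous_finsetSum _ fun j _ => ?_)
  exact (hm z j hu).mul (Complex.continuous_conj.comp (hm _ j hw))

end Form

section Bounds

variable {k m : ℕ} {M : Type*} [EMetricSpace M]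
  {b : Module.Basis (Fin m) ℝ (EuclideanSpace ℝ (Fin m))}

lemma exists_bound_of_periodic [CompactSpace M] {F : M × EuclideanSpace ℝ (Fin m) → ℂ}
    (hF : Continuous F)
    (hp : ∀ x y, ∀ v ∈ Submodule.span ℤ (Set.range b), F (x, y + v) = F (x, y)) :
    ∃ C, ∀ p, ‖F p‖ ≤ C := by
  have hK : IsCompact ((Set.univ : Set M) ×ˢ closure (ZSpan.fundamentalDomain b)) :=
    isCompact_univ.prod (ZSpan.fundamentalDomain_isBounded b).isCompact_closure
  obtain ⟨C, hC⟩ := hK.exists_bound_of_continuousOn hF.continuousOn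
  refine ⟨C, fun p => ?_⟩
  have h := comp_cylShift_of_periodic hp 0 p
  rw [add_zero] at h
  rw [← h]
  exact hC _ ⟨trivial, subset_closure (ZSpan.fract_mem_fundamentalDomain b _)⟩

lemma inner_toLp_eq_integral [MeasurableSpace M] [BorelSpace M]
    {F : M × EuclideanSpace ℝ (Fin m) → ℂ}
    (hF : MemLp F 2 (cylMeasure (k := k) M b)) (f : CylL2 k M b) :
    inner ℂ (hF.toLp F) f = ∫ p, f p * conj (F p) ∂(cylMeasure (k := k) M b) := by
  rw [L2.inner_def]
  refine integral_congr_ae ?_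
  filter_upwards [hF.coeFn_toLp] with p hp
  rw [hp, RCLike.inner_apply]

end Bounds

/-! ### The core in `L₂`, translations and the derivative along the torus -/

section L2

variable {k m : ℕ} {H : Type*} [TopologicalSpace H]
  {I : ModelWithCorners ℝ (EuclideanSpace ℝ (Fin k)) H}
  {M : Type*} [EMetricSpace M] [CompactSpace M] [MeasurableSpace M] [BorelSpace M]
  [ChartedSpace H M] [IsFiniteMeasure (μHE[k] : Measure M)]
  {b : Module.Basis (Fin m) ℝ (EuclideanSpace ℝ (Fin m))} {bc : BoundaryCondition}

variable (k I M b bc) in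
/-- The embedding of the core into `L₂(M × 𝕋)`. -/
def coreToL2 : coreSubmodule I M b bc →ₗ[ℂ] CylL2 k M b where
  toFun u := (u.2.1.continuous.memLp_cylMeasure b 2).toLp u.1
  map_add' _ _ := rfl
  map_smul' _ _ := rfl

variable (k M b) in
/-- The unitary translation of `L₂(M × 𝕋)` by the vector `v` of the torus. -/
def l2Translate (v : EuclideanSpace ℝ (Fin m)) : CylL2 k M b →ₗᵢ[ℂ] CylL2 k M b :=
  Lp.compMeasurePreservingₗᵢ ℂ (cylShift b v) (measurePreserving_cylShift b v)

lemma inner_coreToL2 (u : coreSubmodule I M b bc) (f : CylL2 k M b) :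
    inner ℂ (coreToL2 k I M b bc u) f = ∫ p, f p * conj (u.1 p) ∂(cylMeasure (k := k) M b) :=
  inner_toLp_eq_integral (u.2.1.continuous.memLp_cylMeasure b 2) f

lemma l2Translate_coreToL2 (v : EuclideanSpace ℝ (Fin m)) (u : coreSubmodule I M b bc) :
    l2Translate k M b v (coreToL2 k I M b bc u) = coreToL2 k I M b bc (coreTranslate v u) := by
  have hu := (u.2.1.continuous.memLp_cylMeasure (k := k) b 2)
  refine (Lp.toLp_compMeasurePreserving hu (measurePreserving_cylShift b v)).trans ?_
  refine MemLp.toLp_congr _ ((coreTranslate v u).2.1.continuous.memLp_cylMeasure b 2)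
    (ae_of_all _ fun p => ?_)
  exact comp_cylShift_of_periodic (fun x y w hw => u.2.periodic x y hw) v p

lemma inner_coreToL2_l2Translate (v : EuclideanSpace ℝ (Fin m)) (u : coreSubmodule I M b bc)
    (f : CylL2 k M b) : inner ℂ (coreToL2 k I M b bc u) (l2Translate k M b v f) =
      inner ℂ (coreToL2 k I M b bc (coreTranslate (-v) u)) f := by
  conv_lhs => rw [← coreTranslate_neg v u, ← l2Translate_coreToL2]
  exact (l2Translate k M b v).inner_map_map _ _

/-- Translations by lattice vectors are trivial on the torus. -/
lemma l2Translate_of_mem {v : EuclideanSpace ℝ (Fin m)}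
    (hv : v ∈ Submodule.span ℤ (Set.range b)) (f : CylL2 k M b) : l2Translate k M b v f = f := by
  refine Lp.ext ?_
  refine (Lp.coeFn_compMeasurePreserving f (measurePreserving_cylShift b v)).trans ?_
  filter_upwards [ae_mem_fundamentalDomain (k := k) (M := M) b] with p hp
  have h : cylShift b v p = p := by
    unfold cylShift
    rw [ZSpan.fract_add_ZSpan b p.2 hv, ZSpan.fract_eq_self.2 hp]
  simp only [Function.comp_apply, h]

lemma tendsto_coreToL2_iff {Φ : ℕ → coreSubmodule I M b bc} {u : CylL2 k M b} :
    Tendsto (fun n => coreToL2 k I M b bc (Φ n)) atTop (𝓝 u) ↔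
      Tendsto (fun n => eLpNorm (fun p => (Φ n).1 p - u p) 2 (cylMeasure (k := k) M b)) atTop
        (𝓝 0) := by
  rw [Lp.tendsto_Lp_iff_tendsto_eLpNorm']
  refine iff_of_eq (congrArg (fun f => Tendsto f atTop (𝓝 0)) ?_)
  ext n
  refine eLpNorm_congr_ae ?_
  filter_upwards [((Φ n).2.1.continuous.memLp_cylMeasure (k := k) b 2).coeFn_toLp] with p hp
  exact congrArg (· - u p) hp

end L2

section Operators

variable {k m : ℕ} {H : Type*} [TopologicalSpace H]
  {I : ModelWithCorners ℝ (EuclideanSpace ℝ (Fin k)) H}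
  {M : Type*} [EMetricSpace M] [CompactSpace M] [MeasurableSpace M] [BorelSpace M]
  [ChartedSpace H M] [IsManifold I ∞ M] [IsFiniteMeasure (μHE[k] : Measure M)]
  {b : Module.Basis (Fin m) ℝ (EuclideanSpace ℝ (Fin m))} {bc : BoundaryCondition}

variable (k I M b bc) in
/-- The derivative along the vector `v` of the torus, as a map from the core to `L₂(M × 𝕋)`. -/
def coreDeriv (v : EuclideanSpace ℝ (Fin m)) : coreSubmodule I M b bc →ₗ[ℂ] CylL2 k M b where
  toFun u := ((u.2.1.continuous_torusDeriv v).memLp_cylMeasure b 2).toLp (torusDeriv v u.1)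
  map_add' u w := by
    rw [← MemLp.toLp_add]
    congr 1
    ext p
    exact torusDeriv_add u.2.1 w.2.1 v p
  map_smul' c u := by
    rw [RingHom.id_apply, ← MemLp.toLp_const_smul]
    congr 1
    ext p
    exact torusDeriv_const_smul u.2.1 v c p

lemma inner_coreDeriv (v : EuclideanSpace ℝ (Fin m)) (u : coreSubmodule I M b bc)
    (f : CylL2 k M b) : inner ℂ (coreDeriv k I M b bc v u) f =
      ∫ p, f p * conj (torusDeriv v u.1 p) ∂(cylMeasure (k := k) M b) :=
  inner_toLp_eq_integral ((u.2.1.continuous_torusDeriv v).memLp_cylMeasure b 2) f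

lemma l2Translate_coreDeriv (v w : EuclideanSpace ℝ (Fin m)) (u : coreSubmodule I M b bc) :
    l2Translate k M b v (coreDeriv k I M b bc w u) =
      coreDeriv k I M b bc w (coreTranslate v u) := by
  have hu := ((u.2.1.continuous_torusDeriv w).memLp_cylMeasure (k := k) b 2)
  refine (Lp.toLp_compMeasurePreserving hu (measurePreserving_cylShift b v)).trans ?_
  refine MemLp.toLp_congr _
    (((coreTranslate v u).2.1.continuous_torusDeriv w).memLp_cylMeasure b 2)
    (ae_of_all _ fun p => ?_)
  refine (comp_cylShift_of_periodic
    (fun x y w' hw => u.2.torusDeriv_periodic w x y hw) v p).trans ?_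
  exact (congrFun (torusDeriv_cylTranslate v w u.1) p).symm

lemma hasDerivAt_inner_coreTranslate (v : EuclideanSpace ℝ (Fin m)) (f : CylL2 k M b)
    (u : coreSubmodule I M b bc) (s : ℝ) :
    HasDerivAt (fun s : ℝ => inner ℂ f (coreToL2 k I M b bc (coreTranslate (s • v) u)))
      (inner ℂ f (coreDeriv k I M b bc v (coreTranslate (s • v) u))) s := by
  have : SecondCountableTopology M := EMetric.secondCountable_of_sigmaCompact M
  have hd := u.2.1.continuous_torusDeriv v
  obtain ⟨C, hC⟩ := exists_bound_of_periodic (b := b) hd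
    (fun x y w hw => u.2.torusDeriv_periodic v x y hw)
  have hc : Continuous u.1 := u.2.1.continuous
  have hf : Integrable f (cylMeasure (k := k) M b) := (Lp.memLp f).integrable (by norm_num)
  have e1 : ∀ s : ℝ, inner ℂ f (coreToL2 k I M b bc (coreTranslate (s • v) u)) =
      ∫ p, u.1 (p.1, p.2 + s • v) * conj (f p) ∂(cylMeasure (k := k) M b) := by
    intro s
    rw [← inner_conj_symm, inner_coreToL2, ← integral_conj]
    refine integral_congr_ae (ae_of_all _ fun p => ?_)
    simp only [map_mul, Complex.conj_conj]
    exact mul_comm _ _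
  have e2 : inner ℂ f (coreDeriv k I M b bc v (coreTranslate (s • v) u)) =
      ∫ p, torusDeriv v u.1 (p.1, p.2 + s • v) * conj (f p) ∂(cylMeasure (k := k) M b) := by
    rw [← inner_conj_symm, inner_coreDeriv, ← integral_conj]
    refine integral_congr_ae (ae_of_all _ fun p => ?_)
    simp only [map_mul, Complex.conj_conj]
    rw [mul_comm, show (coreTranslate (s • v) u).1 = cylTranslate (s • v) u.1 from rfl,
      torusDeriv_cylTranslate]
    rfl
  simp only [e1, e2]
  have hm : ∀ {F : M × EuclideanSpace ℝ (Fin m) → ℂ}, Continuous F → ∀ s : ℝ,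
      AEStronglyMeasurable (fun p => F (p.1, p.2 + s • v) * conj (f p))
        (cylMeasure (k := k) M b) := fun {F} hF s =>
    (hF.comp (by fun_prop : Continuous fun p : M × EuclideanSpace ℝ (Fin m) =>
      (p.1, p.2 + s • v))).aestronglyMeasurable.mul
      (Complex.continuous_conj.comp_aestronglyMeasurable hf.1)
  have hfi : Integrable (fun p => conj (f p)) (cylMeasure (k := k) M b) :=
    hf.congr' (Complex.continuous_conj.comp_aestronglyMeasurable hf.1) (by simp)
  obtain ⟨C', hC'⟩ := exists_bound_of_periodic (b := b) hc (fun x y w hw => u.2.periodic x y hw)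
  refine (hasDerivAt_integral_of_dominated_loc_of_deriv_le
    (F := fun (s : ℝ) p => u.1 (p.1, p.2 + s • v) * conj (f p))
    (F' := fun (s : ℝ) p => torusDeriv v u.1 (p.1, p.2 + s • v) * conj (f p))
    (bound := fun p => C * ‖f p‖) univ_mem (Eventually.of_forall (hm hc)) ?_ (hm hd s) ?_ ?_ ?_).2
  · refine hfi.bdd_mul (c := C') ?_ ?_
    · exact (hc.comp (by fun_prop : Continuous fun p : M × EuclideanSpace ℝ (Fin m) =>
        (p.1, p.2 + s • v))).aestronglyMeasurable
    · exact ae_of_all _ fun p => hC' _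
  · refine ae_of_all _ fun p s _ => ?_
    rw [norm_mul, RCLike.norm_conj]
    exact mul_le_mul_of_nonneg_right (hC _) (norm_nonneg _)
  · exact hf.norm.const_mul C
  · refine ae_of_all _ fun p s _ => ?_
    exact (IsCore.hasDerivAt_line u.2 v p s).mul_const _

/-- Integration by parts along the torus: differentiate the invariance of the inner product under
translations. -/
lemma inner_coreToL2_coreDeriv (v : EuclideanSpace ℝ (Fin m)) (u w : coreSubmodule I M b bc) :
    inner ℂ (coreToL2 k I M b bc u) (coreDeriv k I M b bc v w) =
      -inner ℂ (coreDeriv k I M b bc v u) (coreToL2 k I M b bc w) := by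
  have h1 := hasDerivAt_inner_coreTranslate (k := k) v (coreToL2 k I M b bc u) w 0
  have h2 : HasDerivAt (fun s : ℝ => inner ℂ (coreToL2 k I M b bc w)
      (coreToL2 k I M b bc (coreTranslate (-s • v) u)))
      (-inner ℂ (coreToL2 k I M b bc w) (coreDeriv k I M b bc v u)) 0 := by
    have h := hasDerivAt_inner_coreTranslate (k := k) v (coreToL2 k I M b bc w) u (-0)
    have h' := HasDerivAt.scomp (0 : ℝ) h (hasDerivAt_neg (0 : ℝ))
    simpa [Function.comp_def] using h'
  have h3 := h2.star
  have e : (fun s : ℝ => inner ℂ (coreToL2 k I M b bc u)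
      (coreToL2 k I M b bc (coreTranslate (s • v) w))) =
      fun s : ℝ => star (inner ℂ (coreToL2 k I M b bc w)
        (coreToL2 k I M b bc (coreTranslate (-s • v) u))) := by
    ext s
    rw [← l2Translate_coreToL2, inner_coreToL2_l2Translate, neg_smul]
    exact (inner_conj_symm _ _).symm
  rw [e] at h1
  have h4 := h1.unique h3
  simp only [zero_smul, coreTranslate_zero] at h4
  rw [h4, star_neg]
  congr 1
  exact inner_conj_symm _ _

/-- The derivative along the torus, extended by continuity, is antisymmetric. -/
lemma inner_deriv_eq_neg {Φ Ψ : ℕ → coreSubmodule I M b bc} {u du v dv : CylL2 k M b}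
    {w : EuclideanSpace ℝ (Fin m)}
    (hu : Tendsto (fun n => coreToL2 k I M b bc (Φ n)) atTop (𝓝 u))
    (hdu : Tendsto (fun n => coreDeriv k I M b bc w (Φ n)) atTop (𝓝 du))
    (hv : Tendsto (fun n => coreToL2 k I M b bc (Ψ n)) atTop (𝓝 v))
    (hdv : Tendsto (fun n => coreDeriv k I M b bc w (Ψ n)) atTop (𝓝 dv)) :
    inner ℂ v du = -inner ℂ dv u := by
  refine tendsto_nhds_unique (hv.inner hdu) ?_
  simp only [inner_coreToL2_coreDeriv]
  exact (hdv.inner hu).neg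

/-- The generator of the translations along `v` is the derivative along `v`, also for the limits
`u` of sequences in the core whose derivatives converge: the difference quotients of
`s ↦ ⟪f, U_s u⟫` are controlled uniformly, because the translations `U_s` are isometries. -/
lemma hasDerivAt_inner_l2Translate {Φ : ℕ → coreSubmodule I M b bc} {u du : CylL2 k M b}
    {v : EuclideanSpace ℝ (Fin m)}
    (hu : Tendsto (fun n => coreToL2 k I M b bc (Φ n)) atTop (𝓝 u))
    (hdu : Tendsto (fun n => coreDeriv k I M b bc v (Φ n)) atTop (𝓝 du))
    (f : CylL2 k M b) (s : ℝ) :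
    HasDerivAt (fun s : ℝ => inner ℂ f (l2Translate k M b (s • v) u))
      (inner ℂ f (l2Translate k M b (s • v) du)) s := by
  refine hasDerivAt_of_tendstoUniformly (l := atTop)
    (f := fun n (s : ℝ) => inner ℂ f (l2Translate k M b (s • v) (coreToL2 k I M b bc (Φ n))))
    (f' := fun n (s : ℝ) => inner ℂ f (l2Translate k M b (s • v) (coreDeriv k I M b bc v (Φ n))))
    (g' := fun s : ℝ => inner ℂ f (l2Translate k M b (s • v) du)) ?_ ?_ ?_ s
  · rw [Metric.tendstoUniformly_iff]
    intro ε hε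
    have h0 : Tendsto (fun n => ‖f‖ * ‖du - coreDeriv k I M b bc v (Φ n)‖) atTop (𝓝 0) := by
      have h1 := ((tendsto_const_nhds (x := du)).sub hdu).norm.const_mul ‖f‖
      rwa [sub_self, norm_zero, mul_zero] at h1
    filter_upwards [h0.eventually_lt_const hε] with n hn s
    rw [dist_eq_norm, ← inner_sub_right, ← map_sub]
    refine (norm_inner_le_norm _ _).trans_lt ?_
    rwa [LinearIsometry.norm_map]
  · refine Eventually.of_forall fun n s => ?_
    simp only [l2Translate_coreToL2, l2Translate_coreDeriv]
    exact hasDerivAt_inner_coreTranslate v f (Φ n) s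
  · intro s
    exact tendsto_const_nhds.inner (((l2Translate k M b (s • v)).continuous.tendsto u).comp hu)

end Operators

/-! ### The free form on the core -/

section FormAlgebra

variable {k m : ℕ} {H : Type*} [TopologicalSpace H]
  {I : ModelWithCorners ℝ (EuclideanSpace ℝ (Fin k)) H}
  {M : Type*} [EMetricSpace M] [MeasurableSpace M] [BorelSpace M] [ChartedSpace H M]
  [RiemannianBundle (fun x : M => TangentSpace I x)]
  {b : Module.Basis (Fin m) ℝ (EuclideanSpace ℝ (Fin m))} {bc : BoundaryCondition}

lemma conj_freeForm (z : Fin m → ℂ) (u w : M × EuclideanSpace ℝ (Fin m) → ℂ) :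
    conj (freeForm I b z u w) = freeForm I b (fun i => conj (z i)) w u := by
  refine integral_conj.symm.trans ?_
  exact integral_congr_ae (ae_of_all _ fun p => conj_formDensity z u w p)

lemma freeForm_smul_left (z : Fin m → ℂ) (c : ℂ) (u w : coreSubmodule I M b bc) :
    freeForm I b z (c • u).1 w.1 = c * freeForm I b z u.1 w.1 := by
  refine Eq.trans ?_ (integral_const_mul c (formDensity I z u.1 w.1))
  exact integral_congr_ae (ae_of_all _ fun p => formDensity_smul_left z u.2.1 c w.1 p)

end FormAlgebra

lemma norm_sq_torusDeriv_le {m : ℕ} {v : EuclideanSpace ℝ (Fin m)} (hv : ‖v‖ = 1) {X : Type*}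
    (u : X × EuclideanSpace ℝ (Fin m) → ℂ) (p : X × EuclideanSpace ℝ (Fin m)) :
    ‖torusDeriv v u p‖ ^ 2 ≤ ∑ j, ‖torusDeriv (EuclideanSpace.single j 1) u p‖ ^ 2 := by
  rw [← sum_mul_torusDeriv_single]
  have h1 : ‖∑ j, (v j : ℂ) * torusDeriv (EuclideanSpace.single j 1) u p‖ ≤
      ∑ j, ‖v j‖ * ‖torusDeriv (EuclideanSpace.single j 1) u p‖ := by
    refine (norm_sum_le _ _).trans (Finset.sum_le_sum fun j _ => ?_)
    rw [norm_mul, Complex.norm_real]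
  have h2 := Finset.sum_mul_sq_le_sq_mul_sq Finset.univ (fun j => ‖v j‖)
    (fun j => ‖torusDeriv (EuclideanSpace.single j 1) u p‖)
  rw [← EuclideanSpace.norm_sq_eq, hv, one_pow, one_mul] at h2
  exact (pow_le_pow_left₀ (norm_nonneg _) h1 2).trans h2

section FreeForm

variable {k m : ℕ} {H : Type*} [TopologicalSpace H]
  {I : ModelWithCorners ℝ (EuclideanSpace ℝ (Fin k)) H}
  {M : Type*} [EMetricSpace M] [CompactSpace M] [MeasurableSpace M] [BorelSpace M]
  [ChartedSpace H M] [IsManifold I ∞ M]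
  [RiemannianBundle (fun x : M => TangentSpace I x)]
  [IsContMDiffRiemannianBundle I ∞ (EuclideanSpace ℝ (Fin k)) (fun x : M => TangentSpace I x)]
  [IsFiniteMeasure (μHE[k] : Measure M)]
  {b : Module.Basis (Fin m) ℝ (EuclideanSpace ℝ (Fin m))} {bc : BoundaryCondition}

lemma integrable_formDensity (z : Fin m → ℂ) (u w : coreSubmodule I M b bc) :
    Integrable (formDensity I z u.1 w.1) (cylMeasure (k := k) M b) :=
  (u.2.1.continuous_formDensity w.2.1 z).integrable_cylMeasure b

lemma freeForm_add_left (z : Fin m → ℂ) (u u' w : coreSubmodule I M b bc) :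
    freeForm I b z (u + u').1 w.1 = freeForm I b z u.1 w.1 + freeForm I b z u'.1 w.1 := by
  refine Eq.trans ?_ (integral_add (integrable_formDensity z u w) (integrable_formDensity z u' w))
  exact integral_congr_ae (ae_of_all _ fun p => formDensity_add_left z u.2.1 u'.2.1 w.1 p)

lemma freeForm_translate (z : Fin m → ℂ) (v : EuclideanSpace ℝ (Fin m))
    (u w : coreSubmodule I M b bc) :
    freeForm I b z (coreTranslate v u).1 (coreTranslate v w).1 = freeForm I b z u.1 w.1 := by
  have : SecondCountableTopology M := EMetric.secondCountable_of_sigmaCompact M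
  have hc := u.2.1.continuous_formDensity w.2.1 z
  have hmp := measurePreserving_cylShift (k := k) (M := M) b v
  have h := integral_map (μ := cylMeasure (k := k) M b) (f := formDensity I z u.1 w.1)
    hmp.measurable.aemeasurable hc.aestronglyMeasurable
  rw [hmp.map_eq] at h
  refine Eq.trans ?_ h.symm
  refine integral_congr_ae (ae_of_all _ fun p => ?_)
  refine (congrFun (formDensity_cylTranslate z v u.1 w.1) p).trans ?_
  exact (comp_cylShift_of_periodic (IsCore.formDensity_periodic u.2 w.2 z) v p).symm

lemma re_freeForm_self {z : Fin m → ℂ} (hz : ∀ i, conj (z i) = z i)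
    (u : coreSubmodule I M b bc) :
    (freeForm I b z u.1 u.1).re = ∫ p, (∑ i, ‖tangentDeriv I u.1 p i‖ ^ 2 +
      ∑ j, ‖magDeriv z u.1 j p‖ ^ 2) ∂(cylMeasure (k := k) M b) := by
  refine (integral_re (integrable_formDensity z u u)).symm.trans ?_
  refine integral_congr_ae (ae_of_all _ fun p => ?_)
  simp only [formDensity_self hz]
  exact Complex.ofReal_re _

lemma integrable_sum_norm_sq {z : Fin m → ℂ} (hz : ∀ i, conj (z i) = z i)
    (u : coreSubmodule I M b bc) :
    Integrable (fun p => ∑ i, ‖tangentDeriv I u.1 p i‖ ^ 2 + ∑ j, ‖magDeriv z u.1 j p‖ ^ 2)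
      (cylMeasure (k := k) M b) := by
  refine (integrable_formDensity z u u).re.congr (ae_of_all _ fun p => ?_)
  simp only [formDensity_self hz]
  exact Complex.ofReal_re _

lemma norm_sq_toLp_eq_integral {F : M × EuclideanSpace ℝ (Fin m) → ℂ} (hF : Continuous F) :
    ‖(hF.memLp_cylMeasure (k := k) b 2).toLp F‖ ^ 2 =
      ∫ p, ‖F p‖ ^ 2 ∂(cylMeasure (k := k) M b) := by
  have h := inner_self_eq_norm_sq_to_K (𝕜 := ℂ) ((hF.memLp_cylMeasure (k := k) b 2).toLp F)
  rw [inner_toLp_eq_integral] at h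
  have h2 : ∫ p, (((hF.memLp_cylMeasure (k := k) b 2).toLp F : CylL2 k M b) p) * conj (F p)
      ∂(cylMeasure (k := k) M b) = ∫ p, ((‖F p‖ ^ 2 : ℝ) : ℂ) ∂(cylMeasure (k := k) M b) := by
    refine integral_congr_ae ?_
    filter_upwards [(hF.memLp_cylMeasure (k := k) b 2).coeFn_toLp] with p hp
    rw [hp, Complex.mul_conj, Complex.normSq_eq_norm_sq]
  rw [h2, integral_complex_ofReal] at h
  refine Complex.ofReal_injective (Eq.trans ?_ h.symm)
  exact Complex.ofReal_pow _ _

lemma integrable_norm_sq {F : M × EuclideanSpace ℝ (Fin m) → ℂ} (hF : Continuous F) :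
    Integrable (fun p => ‖F p‖ ^ 2) (cylMeasure (k := k) M b) :=
  (hF.memLp_cylMeasure b 2).integrable_norm_pow (by norm_num)

/-- The derivative along a unit vector of the torus is bounded in the form norm. -/
lemma norm_sq_coreDeriv_le {v : EuclideanSpace ℝ (Fin m)} (hv : ‖v‖ = 1)
    (u : coreSubmodule I M b bc) :
    ‖coreDeriv k I M b bc v u‖ ^ 2 ≤ (freeForm I b 0 u.1 u.1).re := by
  have hz : ∀ i : Fin m, conj ((0 : Fin m → ℂ) i) = (0 : Fin m → ℂ) i := by simp
  refine (norm_sq_toLp_eq_integral (k := k) (b := b) (u.2.1.continuous_torusDeriv v)).trans_le ?_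
  rw [re_freeForm_self hz]
  refine integral_mono (integrable_norm_sq (u.2.1.continuous_torusDeriv v))
    (integrable_sum_norm_sq hz u) fun p => ?_
  refine (norm_sq_torusDeriv_le hv u.1 p).trans ?_
  simp only [magDeriv_eq, Pi.zero_apply, mul_zero, zero_mul, add_zero]
  exact le_add_of_nonneg_left (Finset.sum_nonneg fun i _ => sq_nonneg _)

lemma re_freeForm_self_nonneg {z : Fin m → ℂ} (hz : ∀ i, conj (z i) = z i)
    (u : coreSubmodule I M b bc) : 0 ≤ (freeForm I b z u.1 u.1).re := by
  rw [re_freeForm_self hz]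
  exact integral_nonneg fun p => by positivity

/-- Convergence in the norm of `H¹` implies convergence for the form with a real quasimomentum. -/
lemma re_freeForm_self_le {z : Fin m → ℂ} (hz : ∀ i, conj (z i) = z i)
    (u : coreSubmodule I M b bc) :
    (freeForm I b z u.1 u.1).re ≤ 2 * (freeForm I b 0 u.1 u.1).re +
      2 * (∑ j, ‖z j‖ ^ 2) * ‖coreToL2 k I M b bc u‖ ^ 2 := by
  have hz0 : ∀ i : Fin m, conj ((0 : Fin m → ℂ) i) = (0 : Fin m → ℂ) i := by simp
  have e := norm_sq_toLp_eq_integral (k := k) (b := b) u.2.1.continuous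
  rw [show ‖coreToL2 k I M b bc u‖ ^ 2 = _ from e, re_freeForm_self hz, re_freeForm_self hz0,
    ← integral_const_mul, ← integral_const_mul, ← integral_add]
  · refine integral_mono (integrable_sum_norm_sq hz u) ?_ fun p => ?_
    · exact ((integrable_sum_norm_sq hz0 u).const_mul 2).add
        ((integrable_norm_sq u.2.1.continuous).const_mul _)
    · have h1 : ∑ j, ‖magDeriv z u.1 j p‖ ^ 2 ≤ ∑ j, (2 * ‖magDeriv 0 u.1 j p‖ ^ 2 +
          2 * ‖z j‖ ^ 2 * ‖u.1 p‖ ^ 2) := by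
        refine Finset.sum_le_sum fun j _ => ?_
        simp only [magDeriv_eq, Pi.zero_apply, mul_zero, zero_mul, add_zero]
        have h := norm_add_le (torusDeriv (EuclideanSpace.single j 1) u.1 p)
          (Complex.I * z j * u.1 p)
        rw [norm_mul, norm_mul, Complex.norm_I, one_mul] at h
        have h' := pow_le_pow_left₀ (norm_nonneg _) h 2
        nlinarith [sq_nonneg (‖torusDeriv (EuclideanSpace.single j 1) u.1 p‖ - ‖z j‖ * ‖u.1 p‖)]
      have h2 : 0 ≤ ∑ i, ‖tangentDeriv I u.1 p i‖ ^ 2 :=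
        Finset.sum_nonneg fun i _ => sq_nonneg _
      rw [Finset.sum_add_distrib, ← Finset.mul_sum, ← Finset.sum_mul, ← Finset.mul_sum] at h1
      simp only
      linarith
  · exact (integrable_sum_norm_sq hz0 u).const_mul 2
  · exact (integrable_norm_sq u.2.1.continuous).const_mul _

variable [NeZero m] {ξ : EuclideanSpace ℝ (Fin m)}

/-- The form of `H₀(τ)` differs from the form of `H₀(0)` by a multiple of the derivative along `b₁`
and a multiple of the inner product of `L₂`. -/
lemma freeForm_quasimomentum (hb : ‖b 0‖ = 1) (hξ : inner ℝ ξ (b 0) = 0) (τ : ℝ)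
    (u w : coreSubmodule I M b bc) :
    freeForm I b (quasimomentum b ξ τ) u.1 w.1 = freeForm I b (quasimomentum b ξ 0) u.1 w.1
      + (2 * τ * inner ℂ (coreToL2 k I M b bc w) (coreDeriv k I M b bc (b 0) u)
        + (2 * Real.pi * Complex.I * τ - τ ^ 2) *
          inner ℂ (coreToL2 k I M b bc w) (coreToL2 k I M b bc u)) := by
  have hu := u.2.1.continuous
  have hw := w.2.1.continuous
  have hdu := u.2.1.continuous_torusDeriv (b 0)
  have hdw := w.2.1.continuous_torusDeriv (b 0)
  have hmul : ∀ {F G : M × EuclideanSpace ℝ (Fin m) → ℂ}, Continuous F → Continuous G →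
      Integrable (fun p => F p * conj (G p)) (cylMeasure (k := k) M b) := fun hF hG =>
    (hF.mul (Complex.continuous_conj.comp hG)).integrable_cylMeasure b
  have e1 : inner ℂ (coreToL2 k I M b bc w) (coreDeriv k I M b bc (b 0) u) =
      ∫ p, torusDeriv (b 0) u.1 p * conj (w.1 p) ∂(cylMeasure (k := k) M b) := by
    rw [inner_coreToL2]
    refine integral_congr_ae ?_
    filter_upwards [(hdu.memLp_cylMeasure (k := k) b 2).coeFn_toLp] with p hp
    exact congrArg (· * conj (w.1 p)) hp
  have e2 : inner ℂ (coreDeriv k I M b bc (b 0) w) (coreToL2 k I M b bc u) =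
      ∫ p, u.1 p * conj (torusDeriv (b 0) w.1 p) ∂(cylMeasure (k := k) M b) := by
    rw [inner_coreDeriv]
    refine integral_congr_ae ?_
    filter_upwards [(hu.memLp_cylMeasure (k := k) b 2).coeFn_toLp] with p hp
    exact congrArg (· * conj (torusDeriv (b 0) w.1 p)) hp
  have e3 : inner ℂ (coreToL2 k I M b bc w) (coreToL2 k I M b bc u) =
      ∫ p, u.1 p * conj (w.1 p) ∂(cylMeasure (k := k) M b) := by
    rw [inner_coreToL2]
    refine integral_congr_ae ?_
    filter_upwards [(hu.memLp_cylMeasure (k := k) b 2).coeFn_toLp] with p hp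
    exact congrArg (· * conj (w.1 p)) hp
  have h : freeForm I b (quasimomentum b ξ τ) u.1 w.1 =
      freeForm I b (quasimomentum b ξ 0) u.1 w.1 + (τ * (
        ∫ p, torusDeriv (b 0) u.1 p * conj (w.1 p) ∂(cylMeasure (k := k) M b) -
        ∫ p, u.1 p * conj (torusDeriv (b 0) w.1 p) ∂(cylMeasure (k := k) M b)) +
        (2 * Real.pi * Complex.I * τ - τ ^ 2) *
          ∫ p, u.1 p * conj (w.1 p) ∂(cylMeasure (k := k) M b)) := by
    rw [← integral_sub (hmul hdu hw) (hmul hu hdw), ← integral_const_mul, ← integral_const_mul,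
      ← integral_add, freeForm, freeForm]
    · refine Eq.trans ?_ (integral_add (integrable_formDensity (quasimomentum b ξ 0) u w) ?_)
      · exact integral_congr_ae (ae_of_all _ fun p =>
          formDensity_quasimomentum hb hξ τ u.1 w.1 p)
      · exact (((hmul hdu hw).sub (hmul hu hdw)).const_mul _).add ((hmul hu hw).const_mul _)
    · exact ((hmul hdu hw).sub (hmul hu hdw)).const_mul _
    · exact (hmul hu hw).const_mul _
  rw [h, ← e1, ← e2, ← e3, inner_coreToL2_coreDeriv]
  ring

lemma conj_quasimomentum_zero (b : Module.Basis (Fin m) ℝ (EuclideanSpace ℝ (Fin m)))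
    (ξ : EuclideanSpace ℝ (Fin m)) (j : Fin m) :
    conj (quasimomentum b ξ 0 j) = quasimomentum b ξ 0 j := by
  simp [quasimomentum]

end FreeForm

/-! ### The form domain and the weak form of the eigenvalue equation -/

lemma cauchySeq_of_norm_sq_sub_le {E : Type*} [NormedAddCommGroup E] {f : ℕ → E}
    {g : ℕ × ℕ → ℝ} (h : ∀ n : ℕ × ℕ, ‖f n.1 - f n.2‖ ^ 2 ≤ g n) (hg : Tendsto g atTop (𝓝 0)) :
    CauchySeq f := by
  rw [cauchySeq_iff_tendsto_dist_atTop_0]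
  have hs : Tendsto (fun n => √(g n)) atTop (𝓝 0) := by
    simpa [Function.comp_def] using (Real.continuous_sqrt.tendsto 0).comp hg
  refine squeeze_zero (fun _ => dist_nonneg) (fun n => ?_) hs
  rw [dist_eq_norm]
  exact Real.le_sqrt_of_sq_le (h n)

section EnergyLimit

universe v

variable {k m : ℕ} {H : Type*} [TopologicalSpace H]
  {I : ModelWithCorners ℝ (EuclideanSpace ℝ (Fin k)) H}
  {M : Type v} [EMetricSpace M] [CompactSpace M] [MeasurableSpace M] [BorelSpace M]
  [ChartedSpace H M] [IsManifold I ∞ M]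
  [RiemannianBundle (fun x : M => TangentSpace I x)]
  [IsFiniteMeasure (μHE[k] : Measure M)]
  {b : Module.Basis (Fin m) ℝ (EuclideanSpace ℝ (Fin m))} {bc : BoundaryCondition}
  [NeZero m] {ξ : EuclideanSpace ℝ (Fin m)}
  {K : Type*} [NormedAddCommGroup K] [InnerProductSpace ℂ K]

/-- `J` maps the core to a Hilbert space so that the form of `H₀(0)` becomes the inner product. -/
def IsEnergyMap (ξ : EuclideanSpace ℝ (Fin m)) (J : coreSubmodule I M b bc →ₗ[ℂ] K) : Prop :=
  ∀ u w, inner ℂ (J w) (J u) = freeForm I b (quasimomentum b ξ 0) u.1 w.1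

/-- The functions `Φ n` of the core converge to `u` in the form norm; `du` is the derivative of `u`
along `b₁`, and `ju` the image of `u` in the Hilbert space of the form of `H₀(0)`. -/
structure IsEnergyLimit (J : coreSubmodule I M b bc →ₗ[ℂ] K) (Φ : ℕ → coreSubmodule I M b bc)
    (u du : CylL2 k M b) (ju : K) : Prop where
  isFormApprox : IsFormApprox I b bc u (fun n => (Φ n).1)
  tendsto : Tendsto (fun n => coreToL2 k I M b bc (Φ n)) atTop (𝓝 u)
  tendsto_deriv : Tendsto (fun n => coreDeriv k I M b bc (b 0) (Φ n)) atTop (𝓝 du)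
  tendsto_energy : Tendsto (fun n => J (Φ n)) atTop (𝓝 ju)

variable {J : coreSubmodule I M b bc →ₗ[ℂ] K} {Φ : ℕ → coreSubmodule I M b bc}
  {u du : CylL2 k M b} {ju : K}

/-- `u` is an eigenvector of `H₀(τ)` for the eigenvalue `h`, in terms of the limits `u`, `du` and
`ju` of a sequence in the core. -/
def IsWeakEigen (J : coreSubmodule I M b bc →ₗ[ℂ] K) (τ : ℝ) (h : ℂ) (u du : CylL2 k M b)
    (ju : K) : Prop :=
  ∀ w, inner ℂ (J w) ju + (2 * τ * inner ℂ (coreToL2 k I M b bc w) du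
        + (2 * Real.pi * Complex.I * τ - τ ^ 2) * inner ℂ (coreToL2 k I M b bc w) u) =
    h * inner ℂ (coreToL2 k I M b bc w) u

/-- Eigenvectors `u` and `v` of `H₀(τ)` with eigenvalues `h` and `h'`: the form of `H₀(0)` is
Hermitian, so that testing the equation of `u` with `v`, and the equation of `v` with `u`, leaves
a relation between the terms of first and zeroth order. -/
lemma IsWeakEigen.inner_deriv {Ψ : ℕ → coreSubmodule I M b bc} {v dv : CylL2 k M b} {jv : K}
    {τ : ℝ} {h h' : ℂ} (hu : IsEnergyLimit J Φ u du ju) (hv : IsEnergyLimit J Ψ v dv jv)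
    (eu : IsWeakEigen J τ h u du ju) (ev : IsWeakEigen J τ h' v dv jv) :
    4 * τ * inner ℂ v du = (h - conj h' - 4 * Real.pi * Complex.I * τ) * inner ℂ v u := by
  have lim : ∀ {Φ Ψ : ℕ → coreSubmodule I M b bc} {u du v dv : CylL2 k M b} {ju jv : K} {h : ℂ},
      IsEnergyLimit J Ψ v dv jv → IsWeakEigen J τ h u du ju →
      inner ℂ jv ju + (2 * τ * inner ℂ v du + (2 * Real.pi * Complex.I * τ - τ ^ 2) * inner ℂ v u)
        = h * inner ℂ v u := by
    intro Φ Ψ u du v dv ju jv h hv eu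
    refine tendsto_nhds_unique ((hv.tendsto_energy.inner tendsto_const_nhds).add
      (((hv.tendsto.inner tendsto_const_nhds).const_mul _).add
        ((hv.tendsto.inner tendsto_const_nhds).const_mul _))) ?_
    simp only [eu _]
    exact (hv.tendsto.inner tendsto_const_nhds).const_mul _
  have h1 := lim (Φ := Φ) hv eu
  have h2 := congrArg conj (lim (Φ := Ψ) hu ev)
  simp only [map_add, map_mul, map_sub, map_pow, Complex.conj_ofReal, Complex.conj_I,
    map_ofNat, inner_conj_symm] at h2
  have h3 := inner_deriv_eq_neg hu.tendsto hu.tendsto_deriv hv.tendsto hv.tendsto_deriv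
  have h4 : inner ℂ dv u = -inner ℂ v du := by rw [h3, neg_neg]
  rw [h4] at h2
  linear_combination h1 - h2

variable
  [IsContMDiffRiemannianBundle I ∞ (EuclideanSpace ℝ (Fin k)) (fun x : M => TangentSpace I x)]

variable (I M b bc ξ) in
lemma exists_isEnergyMap : ∃ (K : Type v) (_ : NormedAddCommGroup K) (_ : InnerProductSpace ℂ K)
    (J : coreSubmodule I M b bc →ₗ[ℂ] K), CompleteSpace K ∧ IsEnergyMap ξ J := by
  obtain ⟨K, i1, i2, J, hK, hJ⟩ := exists_inner_eq_of_nonneg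
    (fun u w : coreSubmodule I M b bc => freeForm I b (quasimomentum b ξ 0) u.1 w.1)
    (fun u w => by
      have h := conj_freeForm (I := I) (b := b) (quasimomentum b ξ 0) u.1 w.1
      simp only [conj_quasimomentum_zero] at h
      exact h)
    (fun u => re_freeForm_self_nonneg (conj_quasimomentum_zero b ξ) u)
    (fun u u' w => freeForm_add_left _ u u' w) (fun c u w => freeForm_smul_left _ c u w)
  exact ⟨K, i1, i2, J, hK, fun u w => hJ u w⟩

/-- A sequence that is Cauchy in the form norm has limits in all three norms. -/
lemma IsFormApprox.exists_isEnergyLimit [CompleteSpace K] (hb : ‖b 0‖ = 1)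
    (hJ : IsEnergyMap ξ J)
    (h : IsFormApprox I b bc u (fun n => (Φ n).1)) :
    ∃ du ju, IsEnergyLimit J Φ u du ju := by
  have h1 := tendsto_coreToL2_iff.2 h.2.1
  have h2 : Tendsto (fun n : ℕ × ℕ => (freeForm I b 0 (Φ n.1 - Φ n.2).1 (Φ n.1 - Φ n.2).1).re)
      atTop (𝓝 0) := by
    have := (Complex.continuous_re.tendsto 0).comp h.2.2
    exact this
  have h3 : Tendsto (fun n : ℕ × ℕ => ‖coreToL2 k I M b bc (Φ n.1 - Φ n.2)‖ ^ 2) atTop (𝓝 0) := by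
    have := cauchySeq_iff_tendsto_dist_atTop_0.1 h1.cauchySeq
    simpa [dist_eq_norm] using this.pow 2
  obtain ⟨du, hdu⟩ := cauchySeq_tendsto_of_complete
    (cauchySeq_of_norm_sq_sub_le (f := fun n => coreDeriv k I M b bc (b 0) (Φ n)) (fun n => by
      rw [← map_sub]
      exact norm_sq_coreDeriv_le hb _) h2)
  have h4 := (h2.const_mul 2).add (h3.const_mul (2 * (∑ j, ‖quasimomentum b ξ 0 j‖ ^ 2)))
  rw [mul_zero, mul_zero, add_zero] at h4
  obtain ⟨ju, hju⟩ := cauchySeq_tendsto_of_complete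
    (cauchySeq_of_norm_sq_sub_le (f := fun n => J (Φ n)) (fun n => by
      rw [← map_sub, ← inner_self_eq_norm_sq (𝕜 := ℂ), hJ]
      exact re_freeForm_self_le (k := k) (conj_quasimomentum_zero b ξ) _) h4)
  exact ⟨du, ju, h, h1, hdu, hju⟩

lemma IsEnergyLimit.tendsto_freeForm (hb : ‖b 0‖ = 1) (hξ : inner ℝ ξ (b 0) = 0)
    (hJ : IsEnergyMap ξ J) (h : IsEnergyLimit J Φ u du ju) (τ : ℝ) (w : coreSubmodule I M b bc) :
    Tendsto (fun n => freeForm I b (quasimomentum b ξ τ) (Φ n).1 w.1) atTop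
      (𝓝 (inner ℂ (J w) ju + (2 * τ * inner ℂ (coreToL2 k I M b bc w) du
        + (2 * Real.pi * Complex.I * τ - τ ^ 2) * inner ℂ (coreToL2 k I M b bc w) u))) := by
  refine Tendsto.congr (fun n => (freeForm_quasimomentum hb hξ τ (Φ n) w).symm) ?_
  refine Tendsto.congr (fun n => congrArg (· + _) (hJ (Φ n) w)) ?_
  exact (tendsto_const_nhds.inner h.tendsto_energy).add
    (((tendsto_const_nhds.inner h.tendsto_deriv).const_mul _).add
      ((tendsto_const_nhds.inner h.tendsto).const_mul _))

/-- The eigenvalue equation for `H₀(τ)` in terms of form limits: the weak equation is the limit of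
the form identity along an approximating sequence. -/
lemma freeOperatorGraph_iff [CompleteSpace K] (hb : ‖b 0‖ = 1) (hξ : inner ℝ ξ (b 0) = 0)
    (hJ : IsEnergyMap ξ J) {τ : ℝ} {h : ℂ} :
    FreeOperatorGraph I b bc (quasimomentum b ξ τ) u (h • u) ↔
      ∃ Φ du ju, IsEnergyLimit J Φ u du ju ∧ IsWeakEigen J τ h u du ju := by
  have key : ∀ w : coreSubmodule I M b bc,
      ∫ p, (h • u : CylL2 k M b) p * conj (w.1 p) ∂(cylMeasure (k := k) M b) =
        h * inner ℂ (coreToL2 k I M b bc w) u := by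
    intro w
    rw [← inner_coreToL2, inner_smul_right]
  constructor
  · rintro ⟨φ, hφ, hlim⟩
    obtain ⟨du, ju, hE⟩ := IsFormApprox.exists_isEnergyLimit (Φ := fun n => ⟨φ n, hφ.1 n⟩) hb hJ hφ
    refine ⟨_, du, ju, hE, fun w => ?_⟩
    rw [← key w]
    exact tendsto_nhds_unique (hE.tendsto_freeForm hb hξ hJ τ w) (hlim w.1 w.2)
  · rintro ⟨Φ, du, ju, hE, hW⟩
    refine ⟨fun n => (Φ n).1, hE.isFormApprox, fun ψ hψ => ?_⟩
    have h1 := hE.tendsto_freeForm hb hξ hJ τ ⟨ψ, hψ⟩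
    rw [hW, ← key] at h1
    exact h1

/-- Translations along the torus map eigenvectors to eigenvectors. -/
lemma IsEnergyLimit.translate [CompleteSpace K] (hb : ‖b 0‖ = 1) (hJ : IsEnergyMap ξ J)
    (hu : IsEnergyLimit J Φ u du ju) {τ : ℝ} {h : ℂ} (eu : IsWeakEigen J τ h u du ju)
    (v : EuclideanSpace ℝ (Fin m)) :
    ∃ ju', IsEnergyLimit J (fun n => coreTranslate v (Φ n)) (l2Translate k M b v u)
        (l2Translate k M b v du) ju' ∧
      IsWeakEigen J τ h (l2Translate k M b v u) (l2Translate k M b v du) ju' := by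
  have h1 : Tendsto (fun n => coreToL2 k I M b bc (coreTranslate v (Φ n))) atTop
      (𝓝 (l2Translate k M b v u)) := by
    simp only [← l2Translate_coreToL2]
    exact ((l2Translate k M b v).continuous.tendsto u).comp hu.tendsto
  have h2 : Tendsto (fun n => coreDeriv k I M b bc (b 0) (coreTranslate v (Φ n))) atTop
      (𝓝 (l2Translate k M b v du)) := by
    simp only [← l2Translate_coreDeriv]
    exact ((l2Translate k M b v).continuous.tendsto du).comp hu.tendsto_deriv
  have h3 : IsFormApprox I b bc (l2Translate k M b v u) (fun n => (coreTranslate v (Φ n)).1) := by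
    refine ⟨fun n => (coreTranslate v (Φ n)).2, tendsto_coreToL2_iff.1 h1, ?_⟩
    have e := hu.isFormApprox.2.2
    refine e.congr fun n => ?_
    exact (freeForm_translate 0 v (Φ n.1 - Φ n.2) (Φ n.1 - Φ n.2)).symm
  obtain ⟨du', ju', h4⟩ := h3.exists_isEnergyLimit hb hJ
  obtain rfl := tendsto_nhds_unique h2 h4.tendsto_deriv
  refine ⟨ju', h4, fun w => ?_⟩
  have e1 : inner ℂ (J w) ju' = inner ℂ (J (coreTranslate (-v) w)) ju := by
    refine tendsto_nhds_unique (tendsto_const_nhds.inner h4.tendsto_energy) ?_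
    refine (tendsto_const_nhds.inner hu.tendsto_energy).congr fun n => ?_
    rw [hJ, hJ, ← freeForm_translate (quasimomentum b ξ 0) v (Φ n), coreTranslate_neg]
  rw [inner_coreToL2_l2Translate, inner_coreToL2_l2Translate, e1]
  exact eu _

end EnergyLimit

/-! ### Eigenspaces of the free operator -/

lemma Submodule.IsOrtho.topologicalClosure {E : Type*} [NormedAddCommGroup E]
    [InnerProductSpace ℂ E] {U V : Submodule ℂ E} (h : U ⟂ V) :
    U.topologicalClosure ⟂ V.topologicalClosure := by
  have hcl : ∀ {U V : Submodule ℂ E}, U ⟂ V → U.topologicalClosure ⟂ V :=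
    fun hUV => Submodule.topologicalClosure_minimal _ hUV (Submodule.isClosed_orthogonal _)
  exact hcl (hcl h.symm).symm

section Eigenspaces

universe v

variable {k m : ℕ} {H : Type*} [TopologicalSpace H]
  {I : ModelWithCorners ℝ (EuclideanSpace ℝ (Fin k)) H}
  {M : Type v} [EMetricSpace M] [CompactSpace M] [MeasurableSpace M] [BorelSpace M]
  [ChartedSpace H M] [IsManifold I ∞ M]
  [RiemannianBundle (fun x : M => TangentSpace I x)]
  [IsFiniteMeasure (μHE[k] : Measure M)]
  {b : Module.Basis (Fin m) ℝ (EuclideanSpace ℝ (Fin m))} {bc : BoundaryCondition}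
  [NeZero m] {ξ : EuclideanSpace ℝ (Fin m)}
  {K : Type*} [NormedAddCommGroup K] [InnerProductSpace ℂ K]
  {J : coreSubmodule I M b bc →ₗ[ℂ] K} {Φ : ℕ → coreSubmodule I M b bc}
  {u du : CylL2 k M b} {ju : K} {τ : ℝ} {h : ℂ}

/-- The eigenvalues of `H₀(0)` are nonnegative, since its form is. -/
lemma IsWeakEigen.nonneg (hu : IsEnergyLimit J Φ u du ju) {μ : ℝ}
    (eu : IsWeakEigen J 0 (μ : ℂ) u du ju) (hu0 : u ≠ 0) : 0 ≤ μ := by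
  have h1 : inner ℂ ju ju = μ * inner ℂ u u := by
    refine tendsto_nhds_unique (hu.tendsto_energy.inner tendsto_const_nhds) ?_
    refine ((hu.tendsto.inner tendsto_const_nhds).const_mul _).congr fun n => ?_
    rw [← eu (Φ n)]
    simp
  rw [inner_self_eq_norm_sq_to_K, inner_self_eq_norm_sq_to_K] at h1
  have h2 : ‖ju‖ ^ 2 = μ * ‖u‖ ^ 2 := by
    refine Complex.ofReal_injective ?_
    rw [Complex.ofReal_mul, Complex.ofReal_pow, Complex.ofReal_pow]
    exact h1
  have h3 : 0 < ‖u‖ ^ 2 := by positivity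
  by_contra hμ
  nlinarith [sq_nonneg ‖ju‖, mul_neg_of_neg_of_pos (not_le.1 hμ) h3]

variable
  [IsContMDiffRiemannianBundle I ∞ (EuclideanSpace ℝ (Fin k)) (fun x : M => TangentSpace I x)]
  [CompleteSpace K]

/-- An eigenvector of `H₀(τ)` is an eigenvector of the translations along `b₁`: the function
`s ↦ ⟪u, U_s u⟫` solves a linear differential equation of first order, so it is `e^{iθs} ‖u‖²`,
and equality holds in the Cauchy–Schwarz inequality. -/
lemma IsWeakEigen.l2Translate_eq (hb : ‖b 0‖ = 1) (hJ : IsEnergyMap ξ J)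
    (hu : IsEnergyLimit J Φ u du ju) (eu : IsWeakEigen J τ h u du ju) (hτ : τ ≠ 0) (s : ℝ) :
    l2Translate k M b (s • b 0) u =
      Complex.exp (((h.im / (2 * τ) - Real.pi : ℝ) * Complex.I) * s) • u := by
  set κ : ℂ := (h.im / (2 * τ) - Real.pi : ℝ) * Complex.I with hκ
  have hτ' : (τ : ℂ) ≠ 0 := Complex.ofReal_ne_zero.2 hτ
  have hd : ∀ s : ℝ, HasDerivAt (fun s : ℝ => inner ℂ u (l2Translate k M b (s • b 0) u))
      (κ * inner ℂ u (l2Translate k M b (s • b 0) u)) s := by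
    intro s
    have h1 := hasDerivAt_inner_l2Translate hu.tendsto hu.tendsto_deriv u s
    obtain ⟨ju', h2, h3⟩ := hu.translate hb hJ eu (s • b 0)
    have h4 := h3.inner_deriv h2 hu eu
    convert h1 using 1
    have h5 : h - conj h = 2 * h.im * Complex.I := by
      rw [Complex.sub_conj]
      push_cast
      ring
    rw [h5] at h4
    have h6 : 4 * (τ : ℂ) * κ = 2 * h.im * Complex.I - 4 * Real.pi * Complex.I * τ := by
      rw [hκ]
      push_cast
      field_simp
      ring
    rw [← h6] at h4
    exact (mul_left_cancel₀ (mul_ne_zero (by norm_num : (4 : ℂ) ≠ 0) hτ')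
      (by rw [h4]; ring)).symm
  have hexp : ∀ s : ℝ, HasDerivAt (fun s : ℝ => Complex.exp (-κ * s))
      (Complex.exp (-κ * s) * (-κ)) s := by
    intro s
    have h1 : HasDerivAt (fun s : ℝ => -κ * (s : ℂ)) (-κ) s := by
      simpa using (Complex.ofRealCLM.hasDerivAt (x := s)).const_mul (-κ)
    exact h1.cexp
  have hconst : ∀ s : ℝ, Complex.exp (-κ * s) * inner ℂ u (l2Translate k M b (s • b 0) u) =
      inner ℂ u u := by
    intro s
    have h1 : ∀ s, HasDerivAt (fun s : ℝ => Complex.exp (-κ * s) *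
        inner ℂ u (l2Translate k M b (s • b 0) u)) 0 s := by
      intro s
      exact ((hexp s).mul (hd s)).congr_deriv (by ring)
    have h2 := is_const_of_deriv_eq_zero (fun s => (h1 s).differentiableAt)
      (fun s => (h1 s).deriv) s 0
    rw [h2, zero_smul, l2Translate_of_mem (Submodule.zero_mem _)]
    simp
  have hF : inner ℂ u (l2Translate k M b (s • b 0) u) = Complex.exp (κ * s) * inner ℂ u u := by
    rw [← hconst s, ← mul_assoc, ← Complex.exp_add]
    simp
  have hn : ‖Complex.exp (κ * s)‖ = 1 := by
    rw [hκ, show (((h.im / (2 * τ) - Real.pi : ℝ) : ℂ) * Complex.I) * (s : ℂ) =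
      (((h.im / (2 * τ) - Real.pi) * s : ℝ) : ℂ) * Complex.I by push_cast; ring]
    exact Complex.norm_exp_ofReal_mul_I _
  have hz : inner ℂ (l2Translate k M b (s • b 0) u) (Complex.exp (κ * s) • u) =
      ((‖u‖ ^ 2 : ℝ) : ℂ) := by
    rw [inner_smul_right, ← inner_conj_symm, hF, map_mul, inner_conj_symm, ← mul_assoc,
      Complex.mul_conj, Complex.normSq_eq_norm_sq, hn, inner_self_eq_norm_sq_to_K, one_pow,
      Complex.ofReal_one, one_mul, Complex.ofReal_pow]
    rfl
  have h0 : ‖l2Translate k M b (s • b 0) u - Complex.exp (κ * s) • u‖ ^ 2 = 0 := by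
    rw [@norm_sub_sq ℂ, norm_smul, hn, LinearIsometry.norm_map, hz, RCLike.re_eq_complex_re,
      Complex.ofReal_re]
    ring
  exact sub_eq_zero.1 (norm_eq_zero.1 (pow_eq_zero_iff two_ne_zero |>.1 h0))

/-- Eigenvectors of `H₀(τ)` are eigenvectors of the derivative along `b₁`: differentiate
`U_s u = e^{iθs} u`. -/
lemma IsWeakEigen.deriv_eq (hb : ‖b 0‖ = 1) (hJ : IsEnergyMap ξ J)
    (hu : IsEnergyLimit J Φ u du ju) (eu : IsWeakEigen J τ h u du ju) (hτ : τ ≠ 0) :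
    du = ((h.im / (2 * τ) - Real.pi : ℝ) * Complex.I) • u := by
  refine ext_inner_left ℂ fun f => ?_
  have h1 := hasDerivAt_inner_l2Translate hu.tendsto hu.tendsto_deriv f 0
  simp only [eu.l2Translate_eq hb hJ hu hτ, inner_smul_right] at h1
  rw [zero_smul, l2Translate_of_mem (Submodule.zero_mem _)] at h1
  set κ : ℂ := (h.im / (2 * τ) - Real.pi : ℝ) * Complex.I
  have h2 : HasDerivAt (fun s : ℝ => κ * (s : ℂ)) κ 0 := by
    simpa using (Complex.ofRealCLM.hasDerivAt (x := (0 : ℝ))).const_mul κ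
  have h3 := h2.cexp.mul_const (inner ℂ f u)
  rw [h1.unique h3, inner_smul_right]
  simp

/-- The imaginary part of an eigenvalue of `H₀(τ)` is an odd multiple of `2πτ`, as the translation
by the lattice vector `b₁` is the identity; hence it is at least `2π|τ|` in absolute value. -/
lemma IsWeakEigen.le_abs_im (hb : ‖b 0‖ = 1) (hJ : IsEnergyMap ξ J)
    (hu : IsEnergyLimit J Φ u du ju) (eu : IsWeakEigen J τ h u du ju) (hτ : τ ≠ 0) (hu0 : u ≠ 0) :
    2 * Real.pi * |τ| ≤ |h.im| := by
  have h1 := eu.l2Translate_eq hb hJ hu hτ 1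
  rw [one_smul, l2Translate_of_mem (Submodule.subset_span ⟨0, rfl⟩), Complex.ofReal_one,
    mul_one] at h1
  have h2 : Complex.exp ((h.im / (2 * τ) - Real.pi : ℝ) * Complex.I) = 1 := by
    have h3 : (Complex.exp ((h.im / (2 * τ) - Real.pi : ℝ) * Complex.I) - 1) • u = 0 := by
      rw [sub_smul, one_smul, ← h1, sub_self]
    exact sub_eq_zero.1 ((smul_eq_zero.1 h3).resolve_right hu0)
  obtain ⟨l, hl⟩ := Complex.exp_eq_one_iff.1 h2
  have h4 : h.im / (2 * τ) - Real.pi = l * (2 * Real.pi) := by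
    have h3 : (((h.im / (2 * τ) - Real.pi : ℝ) : ℂ)) = ((l * (2 * Real.pi) : ℝ) : ℂ) := by
      refine mul_right_cancel₀ Complex.I_ne_zero (hl.trans ?_)
      push_cast
      ring
    exact Complex.ofReal_injective h3
  have h5 : h.im = 2 * Real.pi * τ * ((2 * l + 1 : ℤ) : ℝ) := by
    have : h.im / (2 * τ) = Real.pi * (2 * l + 1) := by linear_combination h4
    rw [div_eq_iff (mul_ne_zero two_ne_zero hτ)] at this
    rw [this]
    push_cast
    ring
  have h6 : (1 : ℝ) ≤ |((2 * l + 1 : ℤ) : ℝ)| := by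
    rw [← Int.cast_abs]
    exact_mod_cast Int.one_le_abs (by omega)
  rw [h5, abs_mul, abs_mul, abs_of_pos Real.two_pi_pos]
  exact le_mul_of_one_le_right (by positivity) h6

/-- The eigenvectors of `H₀(τ)` are eigenvectors of `H₀(0)`. -/
lemma IsWeakEigen.isWeakEigen_zero (hb : ‖b 0‖ = 1) (hJ : IsEnergyMap ξ J)
    (hu : IsEnergyLimit J Φ u du ju) (eu : IsWeakEigen J τ h u du ju) (hτ : τ ≠ 0) :
    IsWeakEigen J 0 ((h.re + τ ^ 2 : ℝ) : ℂ) u du ju := by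
  intro w
  have hτ' : (τ : ℂ) ≠ 0 := Complex.ofReal_ne_zero.2 hτ
  have h1 := eu w
  rw [eu.deriv_eq hb hJ hu hτ, inner_smul_right] at h1 ⊢
  have h2 : h = h.re + h.im * Complex.I := (Complex.re_add_im h).symm
  have h3 : 2 * (τ : ℂ) * ((h.im / (2 * τ) - Real.pi : ℝ) * Complex.I) =
      h.im * Complex.I - 2 * Real.pi * Complex.I * τ := by
    push_cast
    field_simp
  rw [← mul_assoc, h3, h2] at h1
  simp only [Complex.ofReal_re, Complex.I_re, mul_zero,
    Complex.ofReal_im, Complex.I_im, mul_one, add_zero, Complex.add_im, Complex.mul_im,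
    zero_add] at h1
  push_cast
  linear_combination h1

/-- The operator `H₀(τ)` is normal: its eigenvectors for different eigenvalues are orthogonal. -/
lemma IsWeakEigen.inner_eq_zero (hb : ‖b 0‖ = 1) (hJ : IsEnergyMap ξ J)
    {Ψ : ℕ → coreSubmodule I M b bc} {v dv : CylL2 k M b} {jv : K} {h' : ℂ}
    (hu : IsEnergyLimit J Φ u du ju) (hv : IsEnergyLimit J Ψ v dv jv)
    (eu : IsWeakEigen J τ h u du ju) (ev : IsWeakEigen J τ h' v dv jv)
    (hτ : τ ≠ 0) (hh : h ≠ h') : inner ℂ v u = 0 := by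
  have hτ' : (τ : ℂ) ≠ 0 := Complex.ofReal_ne_zero.2 hτ
  have h1 := eu.inner_deriv hu hv ev
  rw [eu.deriv_eq hb hJ hu hτ, inner_smul_right] at h1
  have h2 : h - conj h = 2 * h.im * Complex.I := by
    rw [Complex.sub_conj]
    push_cast
    ring
  have h3 : 4 * (τ : ℂ) * ((h.im / (2 * τ) - Real.pi : ℝ) * Complex.I) =
      h - conj h - 4 * Real.pi * Complex.I * τ := by
    rw [h2]
    push_cast
    field_simp
    ring
  rw [← mul_assoc, h3] at h1
  have h4 : (conj h' - conj h) * inner ℂ v u = 0 := by linear_combination h1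
  refine (mul_eq_zero.1 h4).resolve_left fun h5 => hh ?_
  exact (star_injective (sub_eq_zero.1 h5)).symm

omit K [NormedAddCommGroup K] [InnerProductSpace ℂ K] [CompleteSpace K]

variable (bc h) in
lemma eigenspaceH0_le (hb : ‖b 0‖ = 1) (hξ : inner ℝ ξ (b 0) = 0) (hτ : τ ≠ 0) :
    (eigenspaceH0 I b bc ξ τ h : Submodule ℂ (CylL2 k M b)) ≤
      eigenspaceH0 I b bc ξ 0 ((h.re + τ ^ 2 : ℝ) : ℂ) := by
  obtain ⟨K, _, _, J, _, hJ⟩ := exists_isEnergyMap I M b bc (ξ := ξ)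
  refine Submodule.topologicalClosure_mono (Submodule.span_mono fun u hu => ?_)
  obtain ⟨Φ, du, ju, hE, hW⟩ := (freeOperatorGraph_iff hb hξ hJ).1 hu
  exact (freeOperatorGraph_iff hb hξ hJ).2 ⟨Φ, du, ju, hE, hW.isWeakEigen_zero hb hJ hE hτ⟩

lemma eigenvalueH0_bounds (hb : ‖b 0‖ = 1) (hξ : inner ℝ ξ (b 0) = 0) (hτ : τ ≠ 0)
    (h0 : (eigenspaceH0 I b bc ξ τ h : Submodule ℂ (CylL2 k M b)) ≠ ⊥) :
    2 * Real.pi * |τ| ≤ |h.im| ∧ 0 ≤ h.re + τ ^ 2 := by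
  obtain ⟨K, _, _, J, _, hJ⟩ := exists_isEnergyMap I M b bc (ξ := ξ)
  obtain ⟨u, hu, hu0⟩ : ∃ u : CylL2 k M b,
      FreeOperatorGraph I b bc (quasimomentum b ξ τ) u (h • u) ∧ u ≠ 0 := by
    by_contra hcon
    push Not at hcon
    refine h0 (eq_bot_iff.2 ?_)
    refine Submodule.topologicalClosure_minimal _ (Submodule.span_le.2 fun u hu => ?_) ?_
    · exact (Submodule.mem_bot ℂ).2 (hcon u hu)
    · simp
  obtain ⟨Φ, du, ju, hE, hW⟩ := (freeOperatorGraph_iff hb hξ hJ).1 hu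
  exact ⟨hW.le_abs_im hb hJ hE hτ hu0, (hW.isWeakEigen_zero hb hJ hE hτ).nonneg hE hu0⟩

lemma isOrtho_eigenspaceH0 (hb : ‖b 0‖ = 1) (hξ : inner ℝ ξ (b 0) = 0) (hτ : τ ≠ 0) {h h' : ℂ}
    (hh : h ≠ h') : (eigenspaceH0 I b bc ξ τ h : Submodule ℂ (CylL2 k M b)) ⟂
      eigenspaceH0 I b bc ξ τ h' := by
  obtain ⟨K, _, _, J, _, hJ⟩ := exists_isEnergyMap I M b bc (ξ := ξ)
  refine Submodule.IsOrtho.topologicalClosure (Submodule.isOrtho_span.2 fun u hu v hv => ?_)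
  obtain ⟨Φ, du, ju, hE, hW⟩ := (freeOperatorGraph_iff hb hξ hJ).1 hu
  obtain ⟨Ψ, dv, jv, hE', hW'⟩ := (freeOperatorGraph_iff hb hξ hJ).1 hv
  exact IsWeakEigen.inner_eq_zero hb hJ hE' hE hW' hW hτ hh.symm

end Eigenspaces

/-! ### Multipliers of orthogonal families -/

section OrthogonalSeries

variable {E : Type*} [NormedAddCommGroup E] [InnerProductSpace ℂ E] [CompleteSpace E]
  {ι : Type*} {W : ι → Submodule ℂ E} {c : ι → ℝ}

lemma norm_sq_sum_smul_starProjection (hW : Pairwise fun i j => W i ⟂ W j) (c : ι → ℝ)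
    (f : E) (s : Finset ι) :
    ‖∑ i ∈ s, ((c i : ℝ) : ℂ) • (W i).topologicalClosure.starProjection f‖ ^ 2 =
      ∑ i ∈ s, c i ^ 2 * ‖(W i).topologicalClosure.starProjection f‖ ^ 2 := by
  have hV : OrthogonalFamily ℂ (fun i => (W i).topologicalClosure)
      (fun i => (W i).topologicalClosure.subtypeₗᵢ) :=
    OrthogonalFamily.of_pairwise fun _ _ hij =>
      Submodule.IsOrtho.topologicalClosure (hW hij)
  have h1 := hV.norm_sum
    (fun i => ((c i : ℝ) : ℂ) • (W i).topologicalClosure.orthogonalProjectionOnto f) s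
  refine (Eq.trans ?_ h1).trans (Finset.sum_congr rfl fun i _ => ?_)
  · rfl
  · rw [norm_smul, mul_pow, Complex.norm_real, Real.norm_eq_abs, sq_abs]
    rfl

/-- Bessel's inequality for the projections onto pairwise orthogonal subspaces. -/
lemma sum_norm_sq_starProjection_le (hW : Pairwise fun i j => W i ⟂ W j) (f : E) (s : Finset ι) :
    ∑ i ∈ s, ‖(W i).topologicalClosure.starProjection f‖ ^ 2 ≤ ‖f‖ ^ 2 := by
  set g := ∑ i ∈ s, (W i).topologicalClosure.starProjection f with hg
  have h1 : ‖g‖ ^ 2 = ∑ i ∈ s, ‖(W i).topologicalClosure.starProjection f‖ ^ 2 := by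
    simpa using norm_sq_sum_smul_starProjection hW (fun _ => 1) f s
  have h2 : RCLike.re (inner ℂ g f) = ‖g‖ ^ 2 := by
    rw [h1, hg, sum_inner, map_sum]
    exact Finset.sum_congr rfl fun i _ => Submodule.re_inner_starProjection_eq_normSq _ _
  have h3 : ‖g‖ ^ 2 ≤ ‖g‖ * ‖f‖ := h2 ▸ re_inner_le_norm g f
  rw [← h1]
  nlinarith [sq_nonneg (‖g‖ - ‖f‖)]

lemma starProjection_closure_eq_zero {V : Submodule ℂ E} (hV : V = ⊥) (f : E) :
    V.topologicalClosure.starProjection f = 0 := by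
  have h1 := V.topologicalClosure.starProjection_apply_mem f
  have h2 : V.topologicalClosure ≤ ⊥ := Submodule.topologicalClosure_minimal _ hV.le (by simp)
  exact (Submodule.mem_bot ℂ).1 (h2 h1)

lemma summable_smul_starProjection (hW : Pairwise fun i j => W i ⟂ W j) {A : ℝ}
    (hc : ∀ i, W i ≠ ⊥ → c i ^ 2 ≤ A) (f : E) :
    Summable fun i => ((c i : ℝ) : ℂ) • (W i).topologicalClosure.starProjection f := by
  have hV : OrthogonalFamily ℂ (fun i => (W i).topologicalClosure)
      (fun i => (W i).topologicalClosure.subtypeₗᵢ) :=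
    OrthogonalFamily.of_pairwise fun _ _ hij =>
      Submodule.IsOrtho.topologicalClosure (hW hij)
  refine (hV.summable_iff_norm_sq_summable
    (fun i => ((c i : ℝ) : ℂ) • (W i).topologicalClosure.orthogonalProjectionOnto f)).2 ?_
  refine Summable.of_nonneg_of_le (fun i => sq_nonneg _) (fun i => ?_)
    ((summable_of_sum_le (fun i => sq_nonneg _) (sum_norm_sq_starProjection_le hW f)).mul_left A)
  rw [norm_smul, mul_pow, Complex.norm_real, Real.norm_eq_abs, sq_abs]
  by_cases hi : W i = ⊥
  · have : (W i).topologicalClosure.starProjection f = 0 := starProjection_closure_eq_zero hi f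
    have h0 : ‖(W i).topologicalClosure.orthogonalProjectionOnto f‖ = 0 :=
      (norm_eq_zero.2 this : ‖(W i).topologicalClosure.starProjection f‖ = 0)
    rw [h0, this]
    simp
  · exact mul_le_mul_of_nonneg_right (hc i hi) (sq_nonneg _)

end OrthogonalSeries

/-! ### From cluster bounds to bounds for multipliers -/

section ClusterSum

variable {X : Type*} [MeasurableSpace X] {μ : Measure X} {q : ℝ≥0∞} {ι : Type*}
  {W : ι → Submodule ℂ (Lp ℂ 2 μ)} {c : ι → ℝ} {N : ι → ℕ} {d w : ℕ → ℝ} {B : ℝ}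

lemma eLpNorm_finset_sum_le (hq : 1 ≤ q) {κ : Type*} (g : κ → Lp ℂ 2 μ) (s : Finset κ) :
    eLpNorm (∑ n ∈ s, g n : Lp ℂ 2 μ) q μ ≤ ∑ n ∈ s, eLpNorm (g n) q μ := by
  refine (eLpNorm_congr_ae (Lp.coeFn_finsetSum s g)).trans_le ?_
  exact eLpNorm_sum_le (fun n _ => Lp.aestronglyMeasurable (g n)) hq

/-- Lower semicontinuity of the norm of `L_q` with respect to the convergence in `L₂`. -/
lemma eLpNorm_tsum_le {a : ι → Lp ℂ 2 μ} (ha : Summable a) {R : ℝ≥0∞}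
    (hR : ∀ s : Finset ι, eLpNorm (∑ i ∈ s, a i : Lp ℂ 2 μ) q μ ≤ R) :
    eLpNorm (∑' i, a i : Lp ℂ 2 μ) q μ ≤ R := by
  have h1 : ∀ n : ℕ, ∃ s : Finset ι, dist (∑ i ∈ s, a i) (∑' i, a i) < 1 / (n + 1) := fun n =>
    ((Metric.tendsto_nhds.1 ha.hasSum) _ Nat.one_div_pos_of_nat).exists
  choose s hs using h1
  have h2 : Tendsto (fun n => ∑ i ∈ s n, a i) atTop (𝓝 (∑' i, a i)) :=
    tendsto_iff_dist_tendsto_zero.2 (squeeze_zero (fun _ => dist_nonneg) (fun n => (hs n).le)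
      tendsto_one_div_add_atTop_nhds_zero_nat)
  obtain ⟨φ, -, hφ⟩ := (tendstoInMeasure_of_tendsto_Lp h2).exists_seq_tendsto_ae
  refine (Lp.eLpNorm_lim_le_liminf_eLpNorm (fun n => Lp.aestronglyMeasurable _) _ hφ).trans ?_
  exact liminf_le_of_frequently_le' (Frequently.of_forall fun n => hR _)

/-- Summing bounds on clusters: if `L_q` is controlled by `d n` times `L₂` on the `n`-th cluster
of the orthogonal family `W`, and the multiplier satisfies `c² ≤ w n` there, the Cauchy–Schwarz
inequality over the clusters bounds the multiplier operator from `L₂` to `L_q` by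
`(∑ n, d n ^ 2 * w n) ^ (1 / 2)`. -/
lemma eLpNorm_sum_smul_starProjection_le (hq : 1 ≤ q) (hW : Pairwise fun i j => W i ⟂ W j)
    (hc : ∀ i, W i ≠ ⊥ → c i ^ 2 ≤ w (N i)) (hd0 : ∀ n, 0 ≤ d n) (hw0 : ∀ n, 0 ≤ w n)
    (hcl : ∀ i, IsClosed (W i : Set (Lp ℂ 2 μ)))
    (hd : ∀ i, ∀ g ∈ ⨆ j, ⨆ _ : N j = N i, W j, eLpNorm g q μ ≤ ENNReal.ofReal (d (N i) * ‖g‖))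
    (hB0 : 0 ≤ B) (hB : ∀ s : Finset ι, ∑ n ∈ s.image N, d n ^ 2 * w n ≤ B ^ 2)
    (f : Lp ℂ 2 μ) (s : Finset ι) :
    eLpNorm (∑ i ∈ s, ((c i : ℝ) : ℂ) • (W i).topologicalClosure.starProjection f : Lp ℂ 2 μ) q μ
      ≤ ENNReal.ofReal (B * ‖f‖) := by
  classical
  set P : ι → Lp ℂ 2 μ := fun i => (W i).topologicalClosure.starProjection f with hP
  set G : ℕ → Lp ℂ 2 μ := fun n => ∑ i ∈ s with N i = n, ((c i : ℝ) : ℂ) • P i with hG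
  set β : ℕ → ℝ := fun n => ∑ i ∈ s with N i = n, ‖P i‖ ^ 2 with hβ
  have hsum : ∑ i ∈ s, ((c i : ℝ) : ℂ) • P i = ∑ n ∈ s.image N, G n :=
    (Finset.sum_fiberwise_of_maps_to (fun i hi => Finset.mem_image_of_mem N hi) _).symm
  have hβ0 : ∀ n, 0 ≤ β n := fun n => Finset.sum_nonneg fun i _ => sq_nonneg _
  have hβs : ∑ n ∈ s.image N, β n ≤ ‖f‖ ^ 2 := by
    rw [hβ, Finset.sum_fiberwise_of_maps_to (fun i hi => Finset.mem_image_of_mem N hi)]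
    exact sum_norm_sq_starProjection_le hW f s
  have hGn : ∀ n, ‖G n‖ ≤ √(w n) * √(β n) := by
    intro n
    rw [← Real.sqrt_mul (hw0 n)]
    refine Real.le_sqrt_of_sq_le ?_
    rw [hG, norm_sq_sum_smul_starProjection hW, hβ, Finset.mul_sum]
    refine Finset.sum_le_sum fun i hi => ?_
    by_cases h0 : W i = ⊥
    · have : P i = 0 := starProjection_closure_eq_zero h0 f
      change c i ^ 2 * ‖P i‖ ^ 2 ≤ w n * ‖P i‖ ^ 2
      rw [this]
      simp
    · rw [← (Finset.mem_filter.1 hi).2]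
      exact mul_le_mul_of_nonneg_right (hc i h0) (sq_nonneg _)
  have hGq : ∀ n ∈ s.image N, eLpNorm (G n) q μ ≤ ENNReal.ofReal (d n * ‖G n‖) := by
    intro n hn
    obtain ⟨i, -, rfl⟩ := Finset.mem_image.1 hn
    refine hd i _ (Submodule.sum_mem _ fun j hj => Submodule.smul_mem _ _ ?_)
    have h1 : W j ≤ ⨆ j, ⨆ _ : N j = N i, W j :=
      le_iSup_of_le j (le_iSup_of_le (Finset.mem_filter.1 hj).2 le_rfl)
    exact h1 ((hcl j).submodule_topologicalClosure_eq ▸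
      (W j).topologicalClosure.starProjection_apply_mem f)
  have hcs : ∑ n ∈ s.image N, √(d n ^ 2 * w n) * √(β n) ≤
      √(∑ n ∈ s.image N, d n ^ 2 * w n) * √(∑ n ∈ s.image N, β n) :=
    Real.sum_sqrt_mul_sqrt_le _ (fun n => mul_nonneg (sq_nonneg _) (hw0 n)) hβ0
  change eLpNorm (∑ i ∈ s, ((c i : ℝ) : ℂ) • P i : Lp ℂ 2 μ) q μ ≤ _
  rw [hsum]
  clear_value β G P
  calc eLpNorm (∑ n ∈ s.image N, G n : Lp ℂ 2 μ) q μ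
      ≤ ∑ n ∈ s.image N, eLpNorm (G n) q μ := eLpNorm_finset_sum_le hq G _
    _ ≤ ∑ n ∈ s.image N, ENNReal.ofReal (√(d n ^ 2 * w n) * √(β n)) := by
        refine Finset.sum_le_sum fun n hn => (hGq n hn).trans (ENNReal.ofReal_le_ofReal ?_)
        rw [Real.sqrt_mul (sq_nonneg _), Real.sqrt_sq (hd0 n), mul_assoc]
        exact mul_le_mul_of_nonneg_left (hGn n) (hd0 n)
    _ = ENNReal.ofReal (∑ n ∈ s.image N, √(d n ^ 2 * w n) * √(β n)) :=
        (ENNReal.ofReal_sum_of_nonneg fun n _ => by positivity).symm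
    _ ≤ ENNReal.ofReal (B * ‖f‖) := by
        refine ENNReal.ofReal_le_ofReal (hcs.trans ?_)
        exact mul_le_mul (Real.sqrt_le_iff.2 ⟨hB0, hB s⟩)
          (Real.sqrt_le_iff.2 ⟨norm_nonneg _, hβs⟩) (Real.sqrt_nonneg _) hB0

end ClusterSum

/-! ### Weights of the clusters -/

section Weights

/-- The weight of the `n`-th cluster: a bound for `|h|⁻¹` for the eigenvalues `h` of `H₀(τ)`, with
`t = |τ|`, whose eigenvectors lie in the range of `E_n`. -/
def clusterWeight (t : ℝ) (n : ℕ) : ℝ := 6 / ((1 + |n - t|) * (n + t))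

/-- With `r ^ 2 = Re h + t ^ 2`, the real part of `h` is `(r - t) * (r + t)`. -/
lemma inv_norm_le_clusterWeight {h : ℂ} {t : ℝ} (ht : 1 ≤ t) (hi : 2 * Real.pi * t ≤ |h.im|)
    (hr : 0 ≤ h.re + t ^ 2) :
    ‖h‖⁻¹ ≤ clusterWeight t (⌊√(h.re + t ^ 2)⌋₊ + 1) := by
  set r := √(h.re + t ^ 2) with hrdef
  have hr0 : 0 ≤ r := Real.sqrt_nonneg _
  have hre : h.re = (r - t) * (r + t) := by
    have := Real.sq_sqrt hr
    linear_combination -this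
  set n := ⌊r⌋₊ + 1
  have hn1 : (n : ℝ) ≤ r + 1 := by
    have := Nat.floor_le hr0
    push_cast [n]
    linarith
  have hn2 : r < n := by
    have := Nat.lt_floor_add_one r
    push_cast [n]
    exact this
  have hn0 : (0 : ℝ) < n + t := by positivity
  have habs : |(n : ℝ) - t| ≤ |r - t| + 1 := by
    have h1 := abs_add_le (r - t) (n - r)
    rw [show r - t + (n - r) = n - t by ring, abs_of_pos (by linarith : (0 : ℝ) < n - r)] at h1
    linarith
  -- near `t` the imaginary part of `h` is used, away from `t` the real part
  have hkey : (1 + |(n : ℝ) - t|) * (n + t) ≤ 6 * ‖h‖ := by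
    rcases le_or_gt |r - t| 1 with h1 | h1
    · have h2 : 6 * t ≤ ‖h‖ := by
        refine le_trans ?_ (hi.trans (Complex.abs_im_le_norm h))
        nlinarith [Real.pi_gt_three]
      have h3 : (n : ℝ) + t ≤ 4 * t := by
        have := (abs_le.1 h1).2
        linarith
      calc (1 + |(n : ℝ) - t|) * (n + t) ≤ 3 * (4 * t) :=
            mul_le_mul (by linarith) h3 hn0.le (by norm_num)
        _ ≤ 6 * ‖h‖ := by linarith
    · have h2 : |r - t| * (r + t) ≤ ‖h‖ := by
        rw [← abs_of_nonneg (by linarith : 0 ≤ r + t), ← abs_mul, ← hre]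
        exact Complex.abs_re_le_norm h
      calc (1 + |(n : ℝ) - t|) * (n + t) ≤ (3 * |r - t|) * (2 * (r + t)) :=
            mul_le_mul (by linarith) (by linarith) hn0.le (by positivity)
        _ = 6 * (|r - t| * (r + t)) := by ring
        _ ≤ 6 * ‖h‖ := by linarith
  have hpos : 0 < (1 + |(n : ℝ) - t|) * (n + t) := by positivity
  have hh : 0 < ‖h‖ := by linarith
  rw [clusterWeight, inv_eq_one_div, div_le_div_iff₀ hh hpos]
  linarith

/-- The power of `n` lost in the cluster bound is absorbed by the factor `n + t` of the weight. -/
lemma rpow_mul_clusterWeight_le {ε t : ℝ} (hε0 : 0 < ε) (hε : ε ≤ 1 / 2) (ht : 1 ≤ t) {n : ℕ}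
    (hn : 1 ≤ n) :
    ((n : ℝ) ^ (1 / 2 - ε)) ^ 2 * clusterWeight t n ≤ 6 * (1 + |n - t|) ^ (-(1 + 2 * ε)) := by
  have hn' : (1 : ℝ) ≤ n := by exact_mod_cast hn
  set x : ℝ := 1 + |(n : ℝ) - t| with hx
  set y : ℝ := n + t with hy
  have hx0 : 0 < x := by positivity
  have hy0 : 0 < y := by positivity
  have hxy : x ≤ y := by
    rcases abs_cases ((n : ℝ) - t) with h | h <;> linarith
  have h1 : ((n : ℝ) ^ (1 / 2 - ε)) ^ 2 ≤ y ^ (1 - 2 * ε) := by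
    rw [← Real.rpow_natCast, ← Real.rpow_mul (by positivity)]
    rw [show (1 / 2 - ε) * ((2 : ℕ) : ℝ) = 1 - 2 * ε by push_cast; ring]
    exact Real.rpow_le_rpow (by positivity) (by linarith) (by linarith)
  have h2 : y ^ (1 - 2 * ε) * (1 / y) = y ^ (-(2 * ε)) := by
    rw [one_div, ← Real.rpow_neg_one, ← Real.rpow_add hy0]
    ring_nf
  have h3 : y ^ (-(2 * ε)) ≤ x ^ (-(2 * ε)) :=
    Real.rpow_le_rpow_of_nonpos hx0 hxy (by linarith)
  have h4 : x ^ (-(2 * ε)) * (1 / x) = x ^ (-(1 + 2 * ε)) := by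
    rw [one_div, ← Real.rpow_neg_one, ← Real.rpow_add hx0]
    ring_nf
  calc ((n : ℝ) ^ (1 / 2 - ε)) ^ 2 * clusterWeight t n
      ≤ y ^ (1 - 2 * ε) * clusterWeight t n := by
        refine mul_le_mul_of_nonneg_right h1 ?_
        rw [clusterWeight]
        positivity
    _ = 6 * (y ^ (1 - 2 * ε) * (1 / y)) * (1 / x) := by
        rw [clusterWeight]
        field_simp
        exact mul_comm y x
    _ ≤ 6 * x ^ (-(2 * ε)) * (1 / x) := by
        rw [h2]
        gcongr
    _ = 6 * x ^ (-(1 + 2 * ε)) := by rw [mul_assoc, h4]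

/-- The sums `∑ n, (1 + |n - t|) ^ (-p)` are bounded uniformly in `t`: shift by the integer part
of `t` and compare with the convergent series of `|l| ^ (-p)` over the integers. -/
lemma exists_sum_rpow_le {p : ℝ} (hp : 1 < p) :
    ∃ A : ℝ, 0 < A ∧ ∀ t : ℝ, ∀ s : Finset ℕ, ∑ n ∈ s, (1 + |n - t|) ^ (-p) ≤ A := by
  have hs : Summable fun l : ℤ => |(l : ℝ)| ^ (-p) := Real.summable_abs_int_rpow hp
  refine ⟨∑' l : ℤ, |(l : ℝ)| ^ (-p) + 1,
    add_pos_of_nonneg_of_pos (tsum_nonneg fun l => by positivity) one_pos, fun t s => ?_⟩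
  set j := ⌊t⌋
  have hle : ∀ n ∈ s, (1 + |(n : ℝ) - t|) ^ (-p) ≤
      |(((n : ℤ) - j : ℤ) : ℝ)| ^ (-p) + if (n : ℤ) = j then 1 else 0 := by
    intro n _
    split_ifs with hn
    · refine (Real.rpow_le_one_of_one_le_of_nonpos (by linarith [abs_nonneg ((n : ℝ) - t)])
        (by linarith)).trans (le_add_of_nonneg_left (by positivity))
    · rw [add_zero]
      have h0 : ((n : ℤ) - j : ℤ) ≠ 0 := sub_ne_zero.2 hn
      refine Real.rpow_le_rpow_of_nonpos (abs_pos.2 (Int.cast_ne_zero.2 h0)) ?_ (by linarith)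
      push_cast
      have h1 := abs_add_le ((n : ℝ) - t) (t - j)
      rw [show (n : ℝ) - t + (t - j) = n - j by ring,
        abs_of_nonneg (sub_nonneg.2 (Int.floor_le t))] at h1
      linarith [Int.lt_floor_add_one t]
  refine (Finset.sum_le_sum hle).trans ?_
  rw [Finset.sum_add_distrib]
  refine add_le_add ?_ ?_
  · have hinj : Function.Injective fun n : ℕ => (n : ℤ) - j := fun a b hab => by
      simpa using hab
    calc ∑ n ∈ s, |(((n : ℤ) - j : ℤ) : ℝ)| ^ (-p)
        ≤ ∑' n : ℕ, |(((n : ℤ) - j : ℤ) : ℝ)| ^ (-p) :=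
          (hs.comp_injective hinj).sum_le_tsum s fun n _ => by positivity
      _ ≤ ∑' l : ℤ, |(l : ℝ)| ^ (-p) :=
          tsum_comp_le_tsum_of_inj hs (fun l => by positivity) hinj
  · rw [Finset.sum_boole]
    have : (s.filter fun n : ℕ => (n : ℤ) = j).card ≤ 1 :=
      Finset.card_le_one.2 fun a ha b hb => by
        have h1 := (Finset.mem_filter.1 ha).2
        have h2 := (Finset.mem_filter.1 hb).2
        omega
    exact_mod_cast this

end Weights

end

theorem mainTheorem5 {k m : ℕ} [NeZero m] {H : Type*} [TopologicalSpace H]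
    (I : ModelWithCorners ℝ (EuclideanSpace ℝ (Fin k)) H)
    (M : Type*) [EMetricSpace M] [CompactSpace M] [MeasurableSpace M] [BorelSpace M]
    [ChartedSpace H M] [IsManifold I ∞ M]
    [RiemannianBundle (fun x : M => TangentSpace I x)]
    [IsContMDiffRiemannianBundle I ∞ (EuclideanSpace ℝ (Fin k))
      (fun x : M => TangentSpace I x)]
    [IsRiemannianManifold I M]
    (b : Module.Basis (Fin m) ℝ (EuclideanSpace ℝ (Fin m))) (hb : ‖b 0‖ = 1)
    (bc : BoundaryCondition) (q : ℝ≥0∞) (hq : 1 ≤ q)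
    (hA : ConditionA I M b bc q)
    (ξ : EuclideanSpace ℝ (Fin m)) (hξ : inner ℝ ξ (b 0) = 0) :
    ∃ τ₀ : ℝ, 0 < τ₀ ∧ ∃ C : ℝ, 0 < C ∧ ∀ τ : ℝ, τ₀ < |τ| → ∀ f : CylL2 k M b,
      Summable (absInvSqrtTerm I b bc ξ τ f) ∧
      eLpNorm (absInvSqrtH0 I b bc ξ τ f) q (cylMeasure (k := k) M b) ≤
        ENNReal.ofReal (C * ‖f‖) := by
  -- finiteness of the volume makes `L₂` contain the core
  have := isFiniteMeasure_euclideanHausdorffMeasure I (M := M)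
  obtain ⟨ε₀, hε₀, C, hC, hcluster⟩ := hA ξ hξ
  -- the exponents `-(1 + 2ε)` of the weights require `ε ≤ 1/2`, which may be assumed
  set ε : ℝ := min ε₀ (1 / 2) with hε
  have hε0 : 0 < ε := lt_min hε₀ (by norm_num)
  obtain ⟨A, hA0, hAsum⟩ := exists_sum_rpow_le (p := 1 + 2 * ε) (by linarith)
  refine ⟨1, one_pos, √(C ^ 2 * (6 * A)), by positivity, fun τ hτ f => ?_⟩
  have hτ0 : τ ≠ 0 := fun h0 => by simp [h0] at hτ; linarith
  set W : ℂ → Submodule ℂ (CylL2 k M b) := fun h => eigenspaceH0 I b bc ξ τ h with hWdef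
  have hW : Pairwise fun h h' => W h ⟂ W h' := fun h h' hh =>
    isOrtho_eigenspaceH0 hb hξ hτ0 hh
  -- the cluster of `H₀(0)` that contains the eigenvectors of `H₀(τ)` for the eigenvalue `h`
  set N : ℂ → ℕ := fun h => ⌊√(h.re + |τ| ^ 2)⌋₊ + 1 with hN
  have hcw : ∀ h, W h ≠ ⊥ → (‖h‖ ^ (-(1 / 2) : ℝ)) ^ 2 ≤ clusterWeight |τ| (N h) := by
    intro h h0
    obtain ⟨h1, h2⟩ := eigenvalueH0_bounds hb hξ hτ0 h0
    rw [← Real.rpow_natCast, ← Real.rpow_mul (norm_nonneg _),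
      show -(1 / 2) * ((2 : ℕ) : ℝ) = -1 by norm_num, Real.rpow_neg_one]
    exact inv_norm_le_clusterWeight hτ.le h1 (by rwa [sq_abs])
  have hw0 : ∀ n, 0 ≤ clusterWeight |τ| n := fun n => by
    rw [clusterWeight]
    positivity
  have hd : ∀ h, ∀ g ∈ ⨆ h', ⨆ _ : N h' = N h, W h',
      eLpNorm g q (cylMeasure (k := k) M b) ≤
        ENNReal.ofReal (C * (N h : ℝ) ^ (1 / 2 - ε) * ‖g‖) := by
    intro h g hg
    have h1 : clusterProj I b bc ξ (N h) g = g := by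
      refine Submodule.starProjection_eq_self_iff.2 (Submodule.le_topologicalClosure _ ?_)
      refine (iSup₂_le fun h' hh' => ?_ : (⨆ h', ⨆ _ : N h' = N h, W h') ≤ _) hg
      by_cases h0 : W h' = ⊥
      · rw [h0]
        exact bot_le
      have h2 := (eigenvalueH0_bounds hb hξ hτ0 h0).2
      refine (eigenspaceH0_le bc h' hb hξ hτ0).trans (le_iSup₂_of_le (h'.re + τ ^ 2) ?_ le_rfl)
      rw [← hh', ← Real.sq_sqrt h2]
      have h3 : N h' = ⌊√(h'.re + τ ^ 2)⌋₊ + 1 := by rw [hN, sq_abs]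
      have h4 := Nat.floor_le (Real.sqrt_nonneg (h'.re + τ ^ 2))
      have h5 := Nat.lt_floor_add_one √(h'.re + τ ^ 2)
      rw [h3, Nat.cast_add, Nat.cast_one, add_sub_cancel_right]
      exact ⟨by gcongr, by gcongr⟩
    have h6 := hcluster (N h) (Nat.le_add_left 1 _) g
    rw [h1] at h6
    refine h6.trans (ENNReal.ofReal_le_ofReal ?_)
    gcongr
    · exact_mod_cast Nat.le_add_left 1 _
    · exact min_le_left _ _
  have hsummable : Summable (absInvSqrtTerm I b bc ξ τ f) := by
    refine summable_smul_starProjection (W := W) (A := 1) hW (fun h h0 => ?_) f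
    have h1 := (eigenvalueH0_bounds hb hξ hτ0 h0).1
    have h2 : 1 ≤ ‖h‖ := by
      refine le_trans ?_ (h1.trans (Complex.abs_im_le_norm h))
      nlinarith [Real.pi_gt_three]
    exact pow_le_one₀ (by positivity) (Real.rpow_le_one_of_one_le_of_nonpos h2 (by norm_num))
  refine ⟨hsummable, eLpNorm_tsum_le hsummable fun s => ?_⟩
  refine eLpNorm_sum_smul_starProjection_le (W := W) (N := N) (w := clusterWeight |τ|)
    (d := fun n => C * (n : ℝ) ^ (1 / 2 - ε)) hq hW hcw (fun n => by positivity) hw0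
    (fun h => Submodule.isClosed_topologicalClosure _) hd (Real.sqrt_nonneg _) (fun s => ?_) f s
  rw [Real.sq_sqrt (by positivity)]
  calc ∑ n ∈ s.image N, (C * (n : ℝ) ^ (1 / 2 - ε)) ^ 2 * clusterWeight |τ| n
      ≤ ∑ n ∈ s.image N, C ^ 2 * (6 * (1 + |(n : ℝ) - (|τ|)|) ^ (-(1 + 2 * ε))) := by
        refine Finset.sum_le_sum fun n hn => ?_
        obtain ⟨h, -, rfl⟩ := Finset.mem_image.1 hn
        rw [mul_pow, mul_assoc]
        exact mul_le_mul_of_nonneg_left (rpow_mul_clusterWeight_le hε0 (min_le_right _ _) hτ.le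
          (Nat.le_add_left 1 _)) (sq_nonneg C)
    _ = C ^ 2 * (6 * ∑ n ∈ s.image N, (1 + |(n : ℝ) - (|τ|)|) ^ (-(1 + 2 * ε))) := by
        rw [← Finset.mul_sum, ← Finset.mul_sum]
    _ ≤ C ^ 2 * (6 * A) := by
        gcongr
        exact hAsum _ _
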